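/- **Setting.** Let $X_1,\dots,X_n\in\mathbb R^p$ be fixed covariates and $Y\sim\mathcal N(\mu,\sigma^2 I_n)$ with $\mu\in\mathbb R^n$ and $\sigma>0$. A split $s=(j,o)\in[p]\times[n-1]$ divides a region $P\subseteq\mathbb R^p$ into $\{z\in P: z_j\le X^j_{(o)}\}$ and $\{z\in P: z_j> X^j_{(o)}\}$, where $X^j_{(o)}$ is the $o$-th order statistic of the $j$-th predictor. For every region $P$ let $\chi_P$ be the set of splits allowed at $P$, let $\tau_P>0$, and let $G(y;P,s)$, $s\in\chi_P$, be a gain function: a measurable function of those responses $y_i$ with $X_i\in P$ (for example the CART gain, the reduction in the sum of squares divided by $\sqrt{n_P}$, where $n_P=|\{i:X_i\in P\}|$). Starting from the root region $\mathbb R^p$, randomized CART of maximal depth $d_{\max}$ splits every region $P$ at depth less than $d_{\max}$ with $n_P>1$ and $\chi_P\ne\emptyset$ by $s^*=\operatorname{argmax}_{s\in\chi_P}\{G(Y;P,s)+W(s)\}$, where the variables $W(s)\sim\mathcal N(0,\tau_P^2)$, at all nodes and for all splits, are independent of each other and of $Y$. Let $S$ be the collection of all splits made (each with its position in the tree), let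 $s$ be a value with $\mathbb P(S=s)>0$, and let $R$ be a terminal region of the tree $s$ with $n_R>0$. Let $P_1,\dots,P_L$ be the successive ancestor regions of $R$, $s^*_l$ the split that $s$ makes at $P_l$, $W_l$ the randomization used there, and $d_l=|\chi_{P_l}|$. Fix $r$ with $1\le r\le d_l-1$ for all $l\in[L]$. Put $(\nu)_i=\mathbf 1[X_i\in R]/\sqrt{n_R}$, $P_\nu^\perp=I_n-\nu\nu^\top/\|\nu\|_2^2$ and, for $z\in\mathbb R^n$ and $t\in\mathbb R$, $y(t)=t\,\nu/\|\nu\|_2^2+z$. **Conditioning.** For $k\in\chi_{P_l}\setminus\{s_l^*\}$ let $$D_l(k)=G(Y;P_l,s^*_l)+W_l(s^*_l)-G(Y;P_l,k)-W_l(k).$$ Let $\mathcal I_l$ be the set of indices of the $d_l-1-r$ largest entries of $D_l$ (ties broken by a fixed rule), $\mathcal L_l$ its complement, which has $r$ elements, and $\mathcal D_l=(D_l(k))_{k\in\mathcal I_l}$. Let $[D_l]_{(r+1)}$ be the $(r+1)$-st smallest entry of $D_l$, that is, the smallest entry of $\mathcal D_l$ ($+\infty$ if $r=d_l-1$). Set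 $A=\{(\mathcal I_l,\mathcal D_l):l\in[L]\}$. **Correction.** Let $\phi(\cdot;m,C)$ denote the Gaussian density with mean $m$ and (co)variance $C$. Let $\beta_l(k)=G(y(t);P_l,s_l^*)-G(y(t);P_l,k)$, with restrictions $\beta^1_l$ to $\mathcal L_l$ and $\beta_l^2$ to $\mathcal I_l$, and let $\Omega_l=\tau_{P_l}^2(I+\mathbf 1\mathbf 1^\top)\in\mathbb R^{(d_l-1)\times(d_l-1)}$, with blocks $\Omega_l^{a,b}$, $a,b\in\{1,2\}$, with respect to $(\mathcal L_l,\mathcal I_l)$. Put $$\bar\beta_l=\beta_l^1+\Omega_l^{1,2}(\Omega_l^{2,2})^{-1}(\mathcal D_l-\beta_l^2),\qquad \Sigma_l=\Omega_l^{1,1}-\Omega_l^{1,2}(\Omega_l^{2,2})^{-1}\Omega_l^{2,1},$$ $$\Gamma(t,z,\mathcal D)=\prod_{l=1}^L\phi(\mathcal D_l;\beta_l^2,\Omega_l^{2,2})\int_{\{u\in\mathbb R^r:\,0<u_k<[D_l]_{(r+1)}\ \forall k\}}\phi(u;\bar\beta_l,\Sigma_l)\,du .$$ **Theorem.** Define $$\widetilde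 P(t_0,z;\theta)=\frac{\int_{-\infty}^{t_0}\phi(t;\theta,\sigma^2\|\nu\|_2^2)\,\Gamma(t,z,\mathcal D)\,dt}{\int_{-\infty}^{\infty}\phi(t;\theta,\sigma^2\|\nu\|_2^2)\,\Gamma(t,z,\mathcal D)\,dt}.$$ Then, conditionally on $S=s$, the random variable $\widetilde P(\nu^\top Y,P_\nu^\perp Y;\nu^\top\mu)$ has the $\mathrm{Unif}(0,1)$ distribution. This remains true under the additional conditioning: given $S=s$, the pivot is independent of $(P_\nu^\perp Y,A)$. The box integrals in $\Gamma$ are $r$-dimensional; for $r=1$ each of them is the integral of a one-dimensional Gaussian density over the interval $(0,[D_l]_{(2)})$, so that $\Gamma$ needs only $L$ one-dimensional integrals. -/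

import Mathlib

open MeasureTheory ProbabilityTheory
open scoped NNReal Matrix

noncomputable section

namespace RRT

/-! ### Covariates, splits, regions, trees -/

/-- A split `(j, o)`: predictor `j` and order statistic `o` of that predictor.  Splits carry the
lexicographic order, which is used as a fixed, data-independent tie-breaking rule. -/
abbrev Split (p n : ℕ) : Type := Fin p ×ₗ Fin (n - 1)

/-- The history of a node of a tree: the successive splits and the sides taken from the root
(`true` is the side `≤`, `false` the side `>`). -/
abbrev Node (p n : ℕ) : Type := List (Split p n × Bool)

variable {p n : ℕ}

/-- The split point: the order statistic `X^j_(o)` of the `j`-th predictor. -/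
def threshold (X : Fin n → Fin p → ℝ) (s : Split p n) : ℝ :=
  X (Tuple.sort (fun i => X i (ofLex s).1) ⟨((ofLex s).2 : ℕ), by omega⟩) (ofLex s).1

/-- The two parts into which the split `s` partitions the region `P`. -/
def child (X : Fin n → Fin p → ℝ) (P : Set (Fin p → ℝ)) (s : Split p n) : Bool → Set (Fin p → ℝ)
  | true => {z | z ∈ P ∧ z (ofLex s).1 ≤ threshold X s}
  | false => {z | z ∈ P ∧ threshold X s < z (ofLex s).1}

/-- The region attached to a node; the root region is all of `ℝ^p`. -/
def region (X : Fin n → Fin p → ℝ) (h : Node p n) : Set (Fin p → ℝ) :=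
  h.foldl (fun P e => child X P e.1 e.2) Set.univ

open Classical in
/-- The observations whose covariates lie in `P`. -/
def obs (X : Fin n → Fin p → ℝ) (P : Set (Fin p → ℝ)) : Finset (Fin n) :=
  Finset.univ.filter (fun i => X i ∈ P)

/-- A gain function `G(y; P, s)` is a measurable function of the responses `y_i` of those
observations `i` whose covariates lie in `P`. -/
def IsGain (X : Fin n → Fin p → ℝ) (G : (Fin n → ℝ) → Set (Fin p → ℝ) → Split p n → ℝ) : Prop :=
  ∀ (P : Set (Fin p → ℝ)) (s : Split p n), Measurable (fun y => G y P s) ∧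
    ∀ y y' : Fin n → ℝ, (∀ i, X i ∈ P → y i = y' i) → G y P s = G y' P s

/-- Within-region sum of squares. -/
def sumSq (X : Fin n → Fin p → ℝ) (y : Fin n → ℝ) (P : Set (Fin p → ℝ)) : ℝ :=
  ∑ i ∈ obs X P, (y i - (∑ k ∈ obs X P, y k) / ((obs X P).card : ℝ)) ^ 2

/-- The CART gain: normalized reduction of the sum of squares. -/
def cartGain (X : Fin n → Fin p → ℝ) (y : Fin n → ℝ) (P : Set (Fin p → ℝ)) (s : Split p n) : ℝ :=
  (1 / √((obs X P).card : ℝ)) *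
    (sumSq X y P - (sumSq X y (child X P s true) + sumSq X y (child X P s false)))

/-- The CART gain is a gain function. -/
theorem isGain_cartGain (X : Fin n → Fin p → ℝ) : IsGain X (cartGain X) := by
  have key : ∀ (P Q : Set (Fin p → ℝ)), Q ⊆ P → ∀ y y' : Fin n → ℝ,
      (∀ i, X i ∈ P → y i = y' i) → sumSq X y Q = sumSq X y' Q := by
    intro P Q hQ y y' hy
    have h1 : ∀ i ∈ obs X Q, y i = y' i := fun i hi => hy i (hQ (by simpa [obs] using hi))
    unfold sumSq
    rw [Finset.sum_congr rfl h1]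
    exact Finset.sum_congr rfl fun i hi => by rw [h1 i hi]
  intro P s
  refine ⟨?_, fun y y' hy => ?_⟩
  · unfold cartGain sumSq
    fun_prop
  · unfold cartGain
    rw [key P P subset_rfl y y' hy, key P (child X P s true) (fun z hz => hz.1) y y' hy,
      key P (child X P s false) (fun z hz => hz.1) y y' hy]

open Classical in
/-- The maximizer of `f` over the nonempty finite set `C` of splits (the first one in case of
ties). -/
def bestSplit (C : Finset (Split p n)) (hC : C.Nonempty) (f : Split p n → ℝ) : Split p n :=
  (C.filter (fun s => ∀ s' ∈ C, f s' ≤ f s)).min' (by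
    obtain ⟨s, hs, hmax⟩ := C.exists_max_image f hC
    exact ⟨s, Finset.mem_filter.2 ⟨hs, hmax⟩⟩)

/-- A binary tree whose internal nodes are labelled by splits: the value of the collection of all
splits made by the tree-growing algorithm. -/
inductive SplitTree (p n : ℕ) : Type
  | leaf : SplitTree p n
  | node (s : Split p n) (left right : SplitTree p n) : SplitTree p n

/-- The histories of the terminal nodes of a tree. -/
def SplitTree.leaves : SplitTree p n → List (Node p n)
  | .leaf => [[]]
  | .node s left right =>
      left.leaves.map (fun h => (s, true) :: h) ++ right.leaves.map (fun h => (s, false) :: h)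

open Classical in
/-- Randomized CART from the node `h` with `k` levels left.  `χ P` is the set of splits allowed at
the region `P`, and `w h s` the randomization added at the node `h` to the gain of the split `s`.
The node is split if `k > 0`, its region has more than one observation and some split is allowed. -/
def grow (X : Fin n → Fin p → ℝ) (χ : Set (Fin p → ℝ) → Finset (Split p n))
    (G : (Fin n → ℝ) → Set (Fin p → ℝ) → Split p n → ℝ)
    (y : Fin n → ℝ) (w : Node p n → Split p n → ℝ) : ℕ → Node p n → SplitTree p n
  | 0, _ => .leaf
  | k + 1, h =>
      if hc : 1 < (obs X (region X h)).card ∧ (χ (region X h)).Nonempty then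
        .node (bestSplit (χ (region X h)) hc.2 (fun s => G y (region X h) s + w h s))
          (grow X χ G y w k (h ++ [(bestSplit (χ (region X h)) hc.2
            (fun s => G y (region X h) s + w h s), true)]))
          (grow X χ G y w k (h ++ [(bestSplit (χ (region X h)) hc.2
            (fun s => G y (region X h) s + w h s), false)]))
      else .leaf

/-! ### The linear statistic -/

open Classical in
/-- The direction `ν_R`, with entries `1[X_i ∈ R] / √n_R`. -/
def nu (X : Fin n → Fin p → ℝ) (R : Set (Fin p → ℝ)) : Fin n → ℝ :=
  fun i => if X i ∈ R then 1 / √((obs X R).card : ℝ) else 0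

/-- The projection `P_ν^⊥ y = (I - ν νᵀ / ‖ν‖²) y`. -/
def projPerp (ν y : Fin n → ℝ) : Fin n → ℝ := y - ((ν ⬝ᵥ y) / (ν ⬝ᵥ ν)) • ν

/-- The reconstruction `y(t) = t ν / ‖ν‖² + z`, where `z` plays the role of `P_ν^⊥ y`. -/
def yAt (ν z : Fin n → ℝ) (t : ℝ) : Fin n → ℝ := (t / (ν ⬝ᵥ ν)) • ν + z

/-! ### Ancestor splits of a terminal node -/

/-- The region of the `l`-th ancestor of the node `h`. -/
def parent (X : Fin n → Fin p → ℝ) (h : Node p n) (l : Fin h.length) : Set (Fin p → ℝ) :=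
  region X (h.take l)

/-- The split made at the `l`-th ancestor of the node `h`. -/
def ancSplit (h : Node p n) (l : Fin h.length) : Split p n := (h.get l).1

/-- The losing splits at the `l`-th ancestor of `h`. -/
abbrev Losers (X : Fin n → Fin p → ℝ) (χ : Set (Fin p → ℝ) → Finset (Split p n))
    (h : Node p n) (l : Fin h.length) : Type :=
  ↥((χ (parent X h l)).erase (ancSplit h l))

/-- Differences of gains `G(y; P_l, s*_l) - G(y; P_l, s)` between the chosen and the losing
splits. -/
def gainDiff (X : Fin n → Fin p → ℝ) (χ : Set (Fin p → ℝ) → Finset (Split p n))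
    (G : (Fin n → ℝ) → Set (Fin p → ℝ) → Split p n → ℝ) (h : Node p n) (y : Fin n → ℝ)
    (l : Fin h.length) : Losers X χ h l → ℝ :=
  fun s => G y (parent X h l) (ancSplit h l) - G y (parent X h l) s

/-- Differences `D_l(s)` of randomized gains between the chosen and the losing splits. -/
def randGainDiff (X : Fin n → Fin p → ℝ) (χ : Set (Fin p → ℝ) → Finset (Split p n))
    (G : (Fin n → ℝ) → Set (Fin p → ℝ) → Split p n → ℝ) (h : Node p n) (y : Fin n → ℝ)
    (w : Node p n → Split p n → ℝ) (l : Fin h.length) : Losers X χ h l → ℝ :=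
  fun s => G y (parent X h l) (ancSplit h l) + w (h.take l) (ancSplit h l)
    - G y (parent X h l) s - w (h.take l) s

/-- The covariance `Ω_l = τ² (I + 1 1ᵀ)` of the differences of randomizations. -/
def Omega (X : Fin n → Fin p → ℝ) (χ : Set (Fin p → ℝ) → Finset (Split p n))
    (τ : Set (Fin p → ℝ) → ℝ≥0) (h : Node p n) (l : Fin h.length) :
    Matrix (Losers X χ h l) (Losers X χ h l) ℝ :=
  ((τ (parent X h l) : ℝ) ^ 2) • (1 + Matrix.of (fun _ _ => (1 : ℝ)))

/-! ### Gaussian densities and the correction factor -/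

/-- Density at `u` of the Gaussian law with mean `m` and (positive definite) covariance `C`, with
respect to Lebesgue measure. -/
def gaussDensity {ι : Type*} [Fintype ι] [DecidableEq ι] (m : ι → ℝ) (C : Matrix ι ι ℝ)
    (u : ι → ℝ) : ℝ :=
  (√((2 * Real.pi) ^ Fintype.card ι * C.det))⁻¹ *
    Real.exp (-(1 / 2) * ((u - m) ⬝ᵥ (C⁻¹ *ᵥ (u - m))))

section Factor

variable {K : Type*} [Fintype K] [DecidableEq K]

/-- The indices of the `card K - r` largest entries of `D`: those with at least `r` entries below
them (ties are ordered by index). -/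
def topIdx [LinearOrder K] (D : K → ℝ) (r : ℕ) : Finset K := by
  classical
  exact Finset.univ.filter
    (fun k => r ≤ (Finset.univ.filter (fun j => D j < D k ∨ (D j = D k ∧ j < k))).card)

/-- Conditional mean `β¹ + Ω¹² (Ω²²)⁻¹ (d - β²)` of the coordinates outside `I` given that those in
`I` equal `d`. -/
def condMean (Ω : Matrix K K ℝ) (β : K → ℝ) (I : Finset K) (d : I → ℝ) : ↥Iᶜ → ℝ :=
  (fun k : ↥Iᶜ => β k) +
    (Ω.submatrix (fun k : ↥Iᶜ => (k : K)) (fun k : I => (k : K))) *ᵥ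
      ((Ω.submatrix (fun k : I => (k : K)) (fun k : I => (k : K)))⁻¹ *ᵥ (d - fun k : I => β k))

/-- Conditional covariance (Schur complement) `Ω¹¹ - Ω¹² (Ω²²)⁻¹ Ω²¹`. -/
def condCov (Ω : Matrix K K ℝ) (I : Finset K) : Matrix ↥Iᶜ ↥Iᶜ ℝ :=
  Ω.submatrix (fun k : ↥Iᶜ => (k : K)) (fun k : ↥Iᶜ => (k : K)) -
    Ω.submatrix (fun k : ↥Iᶜ => (k : K)) (fun k : I => (k : K)) *
      (Ω.submatrix (fun k : I => (k : K)) (fun k : I => (k : K)))⁻¹ *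
      Ω.submatrix (fun k : I => (k : K)) (fun k : ↥Iᶜ => (k : K))

/-- The smallest of the values `d`.  When `I` indexes the `card K - r` largest entries of a vector
and `d` lists these entries, this is the `(r+1)`-st order statistic (`⊤` if `r = card K`). -/
def minVal (I : Finset K) (d : I → ℝ) : EReal := ⨅ k : I, (d k : EReal)

/-- The marginal Gaussian density of the coordinates in `I` at `d`. -/
def topDensity (Ω : Matrix K K ℝ) (β : K → ℝ) (I : Finset K) (d : I → ℝ) : ℝ :=
  gaussDensity (fun k : I => β k) (Ω.submatrix (fun k : I => (k : K)) (fun k : I => (k : K))) d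

/-- The box `{u : 0 < u_k < minVal}` in the coordinates outside `I`. -/
def box (I : Finset K) (d : I → ℝ) : Set (↥Iᶜ → ℝ) :=
  {u | ∀ k, 0 < u k ∧ (u k : EReal) < minVal I d}

/-- The factor of the correction at one split: a Gaussian density times a Gaussian box integral. -/
def gammaFactor (Ω : Matrix K K ℝ) (β : K → ℝ) (I : Finset K) (d : I → ℝ) : ℝ :=
  topDensity Ω β I d * ∫ u in box I d, gaussDensity (condMean Ω β I d) (condCov Ω I) u

end Factor

/-! ### The pivot -/

/-- The correction `Γ(t, z, 𝒟)`: the product of the factors over the ancestor splits. -/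
def gammaProd (X : Fin n → Fin p → ℝ) (χ : Set (Fin p → ℝ) → Finset (Split p n))
    (G : (Fin n → ℝ) → Set (Fin p → ℝ) → Split p n → ℝ) (τ : Set (Fin p → ℝ) → ℝ≥0)
    (h : Node p n) (I : ∀ l, Finset (Losers X χ h l)) (d : ∀ l, I l → ℝ) (t : ℝ)
    (z : Fin n → ℝ) : ℝ :=
  ∏ l, gammaFactor (Omega X χ τ h l) (gainDiff X χ G h (yAt (nu X (region X h)) z t) l) (I l) (d l)

/-- The pivot as a function of `t₀ = νᵀ y`, `z = P_ν^⊥ y`, `θ = νᵀ μ` and the additionally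
conditioned data `(I, d)`. -/
def pivot (X : Fin n → Fin p → ℝ) (χ : Set (Fin p → ℝ) → Finset (Split p n))
    (G : (Fin n → ℝ) → Set (Fin p → ℝ) → Split p n → ℝ) (τ : Set (Fin p → ℝ) → ℝ≥0) (σ : ℝ≥0)
    (h : Node p n) (I : ∀ l, Finset (Losers X χ h l)) (d : ∀ l, I l → ℝ)
    (t₀ : ℝ) (z : Fin n → ℝ) (θ : ℝ) : ℝ :=
  (∫ t in Set.Iic t₀,
      gaussianPDFReal θ (σ ^ 2 * (nu X (region X h) ⬝ᵥ nu X (region X h)).toNNReal) t *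
        gammaProd X χ G τ h I d t z) /
    ∫ t, gaussianPDFReal θ (σ ^ 2 * (nu X (region X h) ⬝ᵥ nu X (region X h)).toNNReal) t *
        gammaProd X χ G τ h I d t z

/-- The indices, at every ancestor split, of the `d_l - 1 - r` largest differences of randomized
gains. -/
def topSets (X : Fin n → Fin p → ℝ) (χ : Set (Fin p → ℝ) → Finset (Split p n))
    (G : (Fin n → ℝ) → Set (Fin p → ℝ) → Split p n → ℝ) (h : Node p n) (r : ℕ) (y : Fin n → ℝ)
    (w : Node p n → Split p n → ℝ) (l : Fin h.length) : Finset (Losers X χ h l) :=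
  topIdx (randGainDiff X χ G h y w l) r

/-- The values of the `d_l - 1 - r` largest differences of randomized gains. -/
def topVals (X : Fin n → Fin p → ℝ) (χ : Set (Fin p → ℝ) → Finset (Split p n))
    (G : (Fin n → ℝ) → Set (Fin p → ℝ) → Split p n → ℝ) (h : Node p n) (r : ℕ) (y : Fin n → ℝ)
    (w : Node p n → Split p n → ℝ) (l : Fin h.length) : topSets X χ G h r y w l → ℝ :=
  fun k => randGainDiff X χ G h y w l k

/-- The additionally conditioned information `A_R = (𝓘_l, (D_l)_{k ∈ 𝓘_l})_l`, coded as the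
membership in `𝓘_l` and the entry (set to `0` outside `𝓘_l`) of each losing split. -/
def condInfo (X : Fin n → Fin p → ℝ) (χ : Set (Fin p → ℝ) → Finset (Split p n))
    (G : (Fin n → ℝ) → Set (Fin p → ℝ) → Split p n → ℝ) (h : Node p n) (r : ℕ) (y : Fin n → ℝ)
    (w : Node p n → Split p n → ℝ) (l : Fin h.length) : Losers X χ h l → Prop × ℝ :=
  fun k => (k ∈ topSets X χ G h r y w l,
    (topSets X χ G h r y w l : Set (Losers X χ h l)).indicator (randGainDiff X χ G h y w l) k)

/-- The pivot evaluated at the data `y` and the randomization `w`, for the mean vector `μ`. -/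
def dataPivot (X : Fin n → Fin p → ℝ) (χ : Set (Fin p → ℝ) → Finset (Split p n))
    (G : (Fin n → ℝ) → Set (Fin p → ℝ) → Split p n → ℝ) (τ : Set (Fin p → ℝ) → ℝ≥0) (σ : ℝ≥0)
    (μ : Fin n → ℝ) (h : Node p n) (r : ℕ) (y : Fin n → ℝ) (w : Node p n → Split p n → ℝ) : ℝ :=
  pivot X χ G τ σ h (topSets X χ G h r y w) (topVals X χ G h r y w)
    (nu X (region X h) ⬝ᵥ y) (projPerp (nu X (region X h)) y) (nu X (region X h) ⬝ᵥ μ)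

end RRT

end

/-!
# Uniformity of the pivot of a randomized regression tree

Write `ν = ν_R`, `U = νᵀY`, `Z = P_ν^⊥ Y`, and let `ε` collect the differences of randomizations
`W(s*_l) - W(k)` at the ancestors of the terminal node `h` and `V` the randomizations at all other
nodes.  Four facts carry the theorem.

* *Independence.*  `U`, `Z`, `ε`, `V` are independent (`map_coords`): `U` and `Z` because they are
  jointly Gaussian and uncorrelated, `ε` and `V` because they involve different nodes.  The law of
  `ε` has independent Gaussian blocks with covariances `τ² (I + 1 1ᵀ)` (`map_noiseDiff`).

* *The selection event.*  The tree `T` is grown iff the subtrees hanging off the path to `h` are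
  those of `T` and the splits on the path win.  The first condition depends on the responses outside
  `R` only, where `Y = Z`, and on `V`; the second one says, up to ties, that the vectors
  `D_l = gainDiff(y(U)) + ε_l` are positive (`grow_eq_iff_coords`).  Ties form a null set.

* *The correction is a density.*  Given `U = t` and `Z = z`, `D_l` is Gaussian with mean
  `β_l(t, z)`.  Its density factors into the marginal density at the entries indexed by `I` and the
  conditional density of the others (`gaussDensity_eq_topDensity_mul`). If `D_l` is positive and `I`
  indexes its `card - r` largest entries, the others range over the box below the smallest of these;
  integrating them out leaves exactly the factor of `Γ` as the density of the conditioned data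
  (`lintegral_pos_gaussDensity`, `setLIntegral_noiseLaw`).

* *Probability integral transform.*  Hence, given `Z`, `V` and the conditioned data, `U` has a
  density proportional to `φ(t; νᵀμ, σ²) Γ(t, Z, 𝒟)` on the selection event, and the pivot is its
  distribution function at `U` (`setLIntegral_probabilityIntegralTransform`,
  `measure_posEvent_inter_pivot`).

Regular conditional laws are never formed: the argument is an identity between probabilities of
events (`measure_grow_inter_dataPivot`).  Since the index set of the conditioned entries is random,
the conditioned data at a split with index type `K` are coded as elements of `K → Prop × ℝ`, and
their laws are compared with the measure `codeMeasure`, which is Lebesgue measure on the positive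
vectors of each possible index set.
-/

noncomputable section

namespace RRT

/-! ### Gaussian densities with respect to a block decomposition -/

section Schur

open Matrix

variable {m n : Type*} [Fintype m] [Fintype n] [DecidableEq m] [DecidableEq n]

/-- Completing the square: the inverse quadratic form of a block matrix splits into the form of the
first block and that of the Schur complement. -/
theorem dotProduct_inv_fromBlocks_mulVec {P : Matrix m m ℝ} {Q : Matrix m n ℝ} {S : Matrix n n ℝ}
    (hP : P.det ≠ 0) (hPs : Pᵀ = P) (hM : (fromBlocks P Q Qᵀ S).det ≠ 0) (x : m → ℝ) (y : n → ℝ) :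
    Sum.elim x y ⬝ᵥ ((fromBlocks P Q Qᵀ S)⁻¹ *ᵥ Sum.elim x y) =
      x ⬝ᵥ (P⁻¹ *ᵥ x) +
        (y - Qᵀ *ᵥ (P⁻¹ *ᵥ x)) ⬝ᵥ ((S - Qᵀ * P⁻¹ * Q)⁻¹ *ᵥ (y - Qᵀ *ᵥ (P⁻¹ *ᵥ x))) := by
  have hPu : IsUnit P.det := isUnit_iff_ne_zero.2 hP
  let := invertibleOfIsUnitDet P hPu
  have hdet : (fromBlocks P Q Qᵀ S).det = P.det * (S - Qᵀ * P⁻¹ * Q).det := by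
    rw [det_fromBlocks₁₁, invOf_eq_nonsing_inv]
  have hCu : IsUnit (S - Qᵀ * P⁻¹ * Q).det :=
    isUnit_iff_ne_zero.2 fun h0 => hM (by rw [hdet, h0, mul_zero])
  set C := S - Qᵀ * P⁻¹ * Q with hC
  set w := y - Qᵀ *ᵥ (P⁻¹ *ᵥ x) with hw
  set u := C⁻¹ *ᵥ w with hu
  have hCu' : C *ᵥ u = w := by
    rw [hu, mulVec_mulVec, mul_nonsing_inv _ hCu, one_mulVec]
  have hPP : ∀ v : m → ℝ, P *ᵥ (P⁻¹ *ᵥ v) = v := fun v => by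
    rw [mulVec_mulVec, mul_nonsing_inv _ hPu, one_mulVec]
  -- the solution of the linear system with right-hand side `(x, y)`, by block elimination
  have hsol : (fromBlocks P Q Qᵀ S) *ᵥ (Sum.elim (P⁻¹ *ᵥ (x - Q *ᵥ u)) u) = Sum.elim x y := by
    rw [fromBlocks_mulVec, Sum.elim_comp_inl, Sum.elim_comp_inr, hPP]
    congr 1
    · simp
    · have : S *ᵥ u = w + Qᵀ *ᵥ (P⁻¹ *ᵥ (Q *ᵥ u)) := by
        rw [← hCu', hC, sub_mulVec, ← mulVec_mulVec, ← mulVec_mulVec, sub_add_cancel]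
      rw [this, hw, mulVec_sub, mulVec_sub]
      abel
  have hinv : (fromBlocks P Q Qᵀ S)⁻¹ *ᵥ Sum.elim x y = Sum.elim (P⁻¹ *ᵥ (x - Q *ᵥ u)) u := by
    rw [← hsol, mulVec_mulVec, nonsing_inv_mul _ (isUnit_iff_ne_zero.2 hM), one_mulVec]
  have hPi : P⁻¹ᵀ = P⁻¹ := by rw [transpose_nonsing_inv, hPs]
  have hcross : x ⬝ᵥ (P⁻¹ *ᵥ (Q *ᵥ u)) = (Qᵀ *ᵥ (P⁻¹ *ᵥ x)) ⬝ᵥ u := by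
    rw [dotProduct_mulVec, dotProduct_mulVec, ← mulVec_transpose, ← mulVec_transpose, hPi]
  rw [hinv, sumElim_dotProduct_sumElim, mulVec_sub, dotProduct_sub, hcross, hw, sub_dotProduct]
  ring

end Schur

section Density

variable {K : Type*} [Fintype K] [DecidableEq K]

/-- The index type as the disjoint union of a finset and its complement. -/
def sumComplEquiv (I : Finset K) : ↥I ⊕ ↥Iᶜ ≃ K :=
  ((Equiv.refl ↥I).sumCongr (Equiv.subtypeEquivRight fun _ => Finset.mem_compl)).trans
    (Equiv.sumCompl (· ∈ I))

/-- The Gaussian density is the product of the marginal density of the coordinates in `I` and the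
conditional density of the remaining ones. -/
theorem gaussDensity_eq_topDensity_mul {Ω : Matrix K K ℝ} (hΩ : Ω.PosDef) (β : K → ℝ)
    (I : Finset K) (D : K → ℝ) :
    gaussDensity β Ω D = topDensity Ω β I (fun k : I => D k) *
      gaussDensity (condMean Ω β I (fun k : I => D k)) (condCov Ω I) (fun k : ↥Iᶜ => D k) := by
  set e := sumComplEquiv I
  set P := Ω.submatrix (fun k : I => (k : K)) (fun k : I => (k : K)) with hP
  set Q := Ω.submatrix (fun k : I => (k : K)) (fun k : ↥Iᶜ => (k : K)) with hQ
  set S := Ω.submatrix (fun k : ↥Iᶜ => (k : K)) (fun k : ↥Iᶜ => (k : K)) with hS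
  have hsymm : Ωᵀ = Ω := by
    have := hΩ.isHermitian.eq
    rwa [Matrix.conjTranspose_eq_transpose_of_trivial] at this
  have hQt : Ω.submatrix (fun k : ↥Iᶜ => (k : K)) (fun k : I => (k : K)) = Qᵀ := by
    rw [hQ, Matrix.transpose_submatrix, hsymm]
  have hblock : Ω.submatrix e e = Matrix.fromBlocks P Q Qᵀ S := by
    rw [← hQt]
    ext (i | i) (j | j) <;> rfl
  have hPpos : 0 < P.det := (hΩ.submatrix Subtype.val_injective).det_pos
  have hMdet : (Matrix.fromBlocks P Q Qᵀ S).det = Ω.det := by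
    rw [← hblock, Matrix.det_submatrix_equiv_self]
  have hMne : (Matrix.fromBlocks P Q Qᵀ S).det ≠ 0 := by rw [hMdet]; exact hΩ.det_pos.ne'
  have hPs : Pᵀ = P := by rw [hP, Matrix.transpose_submatrix, hsymm]
  have hC : condCov Ω I = S - Qᵀ * P⁻¹ * Q := by simp only [condCov, hQt]; rfl
  let := Matrix.invertibleOfIsUnitDet P (isUnit_iff_ne_zero.2 hPpos.ne')
  have hdet : Ω.det = P.det * (condCov Ω I).det := by
    rw [← hMdet, Matrix.det_fromBlocks₁₁, Matrix.invOf_eq_nonsing_inv, hC]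
  set x : I → ℝ := (fun k : I => D k) - fun k : I => β k with hx
  set y : ↥Iᶜ → ℝ := (fun k : ↥Iᶜ => D k) - fun k : ↥Iᶜ => β k with hy
  have hm : (fun k : ↥Iᶜ => D k) - condMean Ω β I (fun k : I => D k) =
      y - Qᵀ *ᵥ (P⁻¹ *ᵥ x) := by
    rw [condMean, hQt, hy]; abel
  have hquad : (D - β) ⬝ᵥ (Ω⁻¹ *ᵥ (D - β)) =
      Sum.elim x y ⬝ᵥ ((Matrix.fromBlocks P Q Qᵀ S)⁻¹ *ᵥ Sum.elim x y) := by
    have hxy : Sum.elim x y = (D - β) ∘ e := by ext (i | i) <;> rfl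
    rw [hxy, ← hblock, Matrix.inv_submatrix_equiv, Matrix.submatrix_mulVec_equiv,
      Function.comp_assoc, Equiv.self_comp_symm, Function.comp_id, comp_equiv_dotProduct_comp_equiv]
  have hcard : Fintype.card K = Fintype.card ↥I + Fintype.card ↥Iᶜ := by
    rw [← Fintype.card_sum]; exact Fintype.card_congr e.symm
  simp only [gaussDensity, topDensity]
  rw [hquad, dotProduct_inv_fromBlocks_mulVec hPpos.ne' hPs hMne, hm, hC, ← hx, hdet, hC, hcard]
  rw [show (2 * Real.pi) ^ (Fintype.card ↥I + Fintype.card ↥Iᶜ) *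
      (P.det * (S - Qᵀ * P⁻¹ * Q).det) =
      ((2 * Real.pi) ^ Fintype.card ↥I * P.det) *
        ((2 * Real.pi) ^ Fintype.card ↥Iᶜ * (S - Qᵀ * P⁻¹ * Q).det) by rw [pow_add]; ring,
    Real.sqrt_mul (by positivity), mul_inv, mul_add, Real.exp_add]
  ring

theorem gaussDensity_nonneg (m : K → ℝ) (C : Matrix K K ℝ) (u : K → ℝ) :
    0 ≤ gaussDensity m C u := by
  unfold gaussDensity; positivity

@[fun_prop]
theorem continuous_gaussDensity (C : Matrix K K ℝ) :
    Continuous fun q : (K → ℝ) × (K → ℝ) => gaussDensity q.1 C q.2 := by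
  unfold gaussDensity; fun_prop

theorem gaussDensity_le {C : Matrix K K ℝ} (hC : C.PosDef) (m u : K → ℝ) :
    gaussDensity m C u ≤ (√((2 * Real.pi) ^ Fintype.card K * C.det))⁻¹ := by
  unfold gaussDensity
  refine mul_le_of_le_one_right (by positivity) (Real.exp_le_one_iff.2 ?_)
  have h := hC.inv.posSemidef.dotProduct_mulVec_nonneg (u - m)
  rw [star_trivial] at h
  linarith

theorem gaussDensity_pos {C : Matrix K K ℝ} (hC : C.PosDef) (m u : K → ℝ) :
    0 < gaussDensity m C u := by
  have := hC.det_pos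
  unfold gaussDensity; positivity

theorem gaussDensity_eq_sub (m : K → ℝ) (C : Matrix K K ℝ) (u : K → ℝ) :
    gaussDensity m C u = gaussDensity 0 C (u - m) := by
  simp [gaussDensity]

/-- The covariance `τ² (I + 1 1ᵀ)` of the differences of one Gaussian variable and others, all
independent with variance `τ²`. -/
def diffCov (K : Type*) [Fintype K] [DecidableEq K] (τ : ℝ≥0) : Matrix K K ℝ :=
  ((τ : ℝ) ^ 2) • (1 + Matrix.of (fun _ _ => (1 : ℝ)))

theorem posDef_diffCov {τ : ℝ≥0} (hτ : 0 < τ) : (diffCov K τ).PosDef := by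
  refine Matrix.PosDef.smul (Matrix.PosDef.one.add_posSemidef ?_) (by positivity)
  have := Matrix.posSemidef_vecMulVec_self_star (fun _ : K => (1 : ℝ))
  convert this using 1
  ext i j; simp [Matrix.vecMulVec]

theorem det_diffCov (τ : ℝ≥0) :
    (diffCov K τ).det = ((τ : ℝ) ^ 2) ^ Fintype.card K * (Fintype.card K + 1) := by
  have hJ : (Matrix.of (fun _ _ => (1 : ℝ)) : Matrix K K ℝ) =
      Matrix.replicateCol Unit (fun _ => (1 : ℝ)) *
        Matrix.replicateRow Unit (fun _ => (1 : ℝ)) := by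
    ext i j; simp [Matrix.mul_apply]
  rw [diffCov, Matrix.det_smul, hJ, Matrix.det_one_add_replicateCol_mul_replicateRow]
  simp [dotProduct, add_comm]

theorem inv_diffCov {τ : ℝ≥0} (hτ : 0 < τ) :
    (diffCov K τ)⁻¹ = (((τ : ℝ) ^ 2)⁻¹) •
      (1 - ((Fintype.card K + 1 : ℝ)⁻¹) • Matrix.of (fun _ _ => (1 : ℝ))) := by
  have hτ' : (τ : ℝ) ^ 2 ≠ 0 := by positivity
  have hm : (Fintype.card K + 1 : ℝ) ≠ 0 := by positivity
  have hJ : (Matrix.of (fun _ _ => (1 : ℝ)) : Matrix K K ℝ) * Matrix.of (fun _ _ => (1 : ℝ)) =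
      (Fintype.card K : ℝ) • Matrix.of (fun _ _ => (1 : ℝ)) := by
    ext i j; simp [Matrix.mul_apply]
  refine Matrix.inv_eq_right_inv ?_
  rw [diffCov, Matrix.smul_mul, Matrix.mul_smul, smul_smul, mul_inv_cancel₀ hτ', one_smul,
    Matrix.mul_sub, Matrix.add_mul, Matrix.mul_smul, Matrix.add_mul, hJ]
  ext i j
  simp only [Matrix.sub_apply, Matrix.add_apply, Matrix.smul_apply, Matrix.of_apply,
    Matrix.one_mul, Matrix.mul_one, smul_eq_mul]
  field_simp
  ring

theorem dotProduct_inv_diffCov_mulVec {τ : ℝ≥0} (hτ : 0 < τ) (e : K → ℝ) :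
    e ⬝ᵥ ((diffCov K τ)⁻¹ *ᵥ e) =
      ((∑ k, e k ^ 2) - (∑ k, e k) ^ 2 / (Fintype.card K + 1)) / (τ : ℝ) ^ 2 := by
  have hJ : (Matrix.of (fun _ _ => (1 : ℝ)) : Matrix K K ℝ) *ᵥ e = fun _ => ∑ k, e k := by
    ext i; simp [Matrix.mulVec, dotProduct]
  rw [inv_diffCov hτ, Matrix.smul_mulVec, Matrix.sub_mulVec, Matrix.one_mulVec,
    Matrix.smul_mulVec, hJ, dotProduct_smul, dotProduct_sub, dotProduct_smul]
  simp only [dotProduct, smul_eq_mul, ← Finset.sum_mul, ← pow_two]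
  field_simp

end Density

/-! ### Products of measures with densities -/

section PiDensity

variable {ι : Type*} [Fintype ι] {α : ι → Type*} [∀ i, MeasurableSpace (α i)]

theorem lintegral_pi_prod_eq_prod (μ : ∀ i, Measure (α i)) [∀ i, SigmaFinite (μ i)]
    {f : ∀ i, α i → ENNReal} (hf : ∀ i, Measurable (f i)) :
    ∫⁻ x, ∏ i, f i (x i) ∂Measure.pi μ = ∏ i, ∫⁻ y, f i y ∂μ i := by
  classical
  by_cases hα : Nonempty (∀ i, α i)
  · obtain ⟨x₀⟩ := hα
    have key : ∀ s : Finset ι, (∫⋯∫⁻_s, (fun x => ∏ i ∈ s, f i (x i)) ∂μ) =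
        fun _ => ∏ i ∈ s, ∫⁻ y, f i y ∂μ i := by
      intro s
      induction s using Finset.induction_on with
      | empty => simp
      | insert i s hi ih =>
        have hms : ∀ t : Finset ι, Measurable fun x : (∀ i, α i) => ∏ i ∈ t, f i (x i) :=
          fun t => Finset.measurable_prod _ fun j _ => (hf j).comp (measurable_pi_apply j)
        rw [lmarginal_insert' _ (hms _) hi]
        have h1 : (fun x : (∀ i, α i) => ∫⁻ y, ∏ j ∈ insert i s, f j (Function.update x i y j) ∂μ i)
            = fun x => (∫⁻ y, f i y ∂μ i) * ∏ j ∈ s, f j (x j) := by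
          funext x
          rw [← lintegral_mul_const _ (hf i)]
          refine lintegral_congr fun y => ?_
          rw [Finset.prod_insert hi, Function.update_self]
          congr 1
          refine Finset.prod_congr rfl fun j hj => ?_
          rw [Function.update_of_ne (by rintro rfl; exact hi hj)]
        rw [h1]
        funext x
        rw [Finset.prod_insert hi, ← congrFun ih x]
        simp only [lmarginal]
        rw [lintegral_const_mul]
        exact (hms s).comp measurable_updateFinset
    rw [lintegral_eq_lmarginal_univ x₀, key]
  · -- some factor is empty, so both sides vanish
    have : ∃ i, IsEmpty (α i) := by
      by_contra hne
      push Not at hne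
      exact hα ⟨fun i => (hne i).some⟩
    obtain ⟨i, hi⟩ := this
    rw [Finset.prod_eq_zero (Finset.mem_univ i) (by simp [lintegral_of_isEmpty])]
    have : IsEmpty (∀ i, α i) := ⟨fun x => hi.elim (x i)⟩
    exact lintegral_of_isEmpty _ _

theorem pi_withDensity (μ : ∀ i, Measure (α i)) [∀ i, SigmaFinite (μ i)]
    {f : ∀ i, α i → ENNReal} (hf : ∀ i, Measurable (f i))
    [∀ i, SigmaFinite ((μ i).withDensity (f i))] :
    Measure.pi (fun i => (μ i).withDensity (f i)) =
      (Measure.pi μ).withDensity fun x => ∏ i, f i (x i) := by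
  refine (Measure.pi_eq fun s hs => ?_)
  rw [withDensity_apply _ (MeasurableSet.univ_pi hs), Measure.restrict_pi_pi,
    lintegral_pi_prod_eq_prod _ hf]
  exact Finset.prod_congr rfl fun i _ => (withDensity_apply _ (hs i)).symm

end PiDensity

/-! ### The law of the differences of randomizations -/

section Noise

variable {K : Type*} [Fintype K] [DecidableEq K]

/-- Integrating out the common variable `a` (by completing the square) from the joint density of
`a` and the differences `e k`. -/
theorem lintegral_gaussianPDF_mul_prod {τ : ℝ≥0} (hτ : 0 < τ) (e : K → ℝ) :
    ∫⁻ a, gaussianPDF 0 (τ ^ 2) a * ∏ k, gaussianPDF 0 (τ ^ 2) (a - e k) =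
      ENNReal.ofReal (gaussDensity 0 (diffCov K τ) e) := by
  have hτ' : (0 : ℝ) < τ := by exact_mod_cast hτ
  set m : ℝ := Fintype.card K + 1 with hm
  have hm0 : 0 < m := by positivity
  set c : ℝ := (∑ k, e k) / m with hc
  set b : ℝ := m / (2 * (τ : ℝ) ^ 2) with hb
  set A : ℝ := (√(2 * Real.pi * (τ : ℝ) ^ 2))⁻¹ ^ (Fintype.card K + 1) *
    Real.exp (-(1 / 2) * (e ⬝ᵥ ((diffCov K τ)⁻¹ *ᵥ e))) with hA
  have hpt : ∀ a : ℝ, gaussianPDF 0 (τ ^ 2) a * ∏ k, gaussianPDF 0 (τ ^ 2) (a - e k) =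
      ENNReal.ofReal (A * Real.exp (-b * (a - c) ^ 2)) := by
    intro a
    simp only [gaussianPDF]
    rw [← ENNReal.ofReal_prod_of_nonneg fun _ _ => gaussianPDFReal_nonneg _ _ _,
      ← ENNReal.ofReal_mul (gaussianPDFReal_nonneg _ _ _)]
    congr 1
    simp only [gaussianPDFReal_def, NNReal.coe_pow, sub_zero]
    rw [Finset.prod_mul_distrib, ← Real.exp_sum, Finset.prod_const, Finset.card_univ, hA,
      mul_mul_mul_comm, ← pow_succ', ← Real.exp_add, mul_assoc _ (Real.exp _), ← Real.exp_add,
      dotProduct_inv_diffCov_mulVec hτ]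
    congr 2
    have h1 : ∑ k, -(a - e k) ^ 2 / (2 * (τ : ℝ) ^ 2) =
        -((m - 1) * a ^ 2 - 2 * a * ∑ k, e k + ∑ k, e k ^ 2) / (2 * (τ : ℝ) ^ 2) := by
      rw [← Finset.sum_div, Finset.sum_neg_distrib]
      congr 2
      simp only [sub_sq, Finset.sum_add_distrib, Finset.sum_sub_distrib, Finset.sum_const,
        Finset.card_univ, nsmul_eq_mul, ← Finset.mul_sum, hm]
      ring
    rw [h1, hb, hc, ← hm]
    field_simp
    ring
  simp_rw [hpt]
  have hb0 : 0 < b := by positivity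
  rw [← ofReal_integral_eq_lintegral_ofReal
    (((integrable_exp_neg_mul_sq hb0).comp_sub_right c).const_mul A)
    (Filter.Eventually.of_forall fun a => by positivity), integral_const_mul,
    integral_sub_right_eq_self (fun a => Real.exp (-b * a ^ 2)) c, integral_gaussian]
  congr 1
  rw [hA, gaussDensity, sub_zero, det_diffCov, ← hm, mul_right_comm]
  congr 1
  have h2 : (2 * Real.pi) ^ Fintype.card K * (((τ : ℝ) ^ 2) ^ Fintype.card K * m) =
      (2 * Real.pi * (τ : ℝ) ^ 2) ^ (Fintype.card K + 1) / (Real.pi / b) := by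
    rw [hb]
    field_simp
    rw [pow_succ, mul_pow, mul_pow]
    ring
  rw [h2, Real.sqrt_div (show 0 ≤ (2 * Real.pi * (τ : ℝ) ^ 2) ^ (Fintype.card K + 1) by positivity),
    inv_div, inv_pow, div_eq_mul_inv, mul_comm]
  congr 2
  rw [← Real.sqrt_sq (pow_nonneg (Real.sqrt_nonneg _) _), pow_right_comm,
    Real.sq_sqrt (by positivity)]

/-- The law of the differences between one Gaussian variable and others, all independent with
variance `τ²`; note that the common variable makes the differences dependent. -/
theorem map_sub_eq_withDensity {τ : ℝ≥0} (hτ : 0 < τ) {Ω : Type*} [MeasurableSpace Ω]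
    {P : Measure Ω} {ξ : Option K → Ω → ℝ} (hξm : ∀ o, Measurable (ξ o))
    (hξ : ∀ o, HasLaw (ξ o) (gaussianReal 0 (τ ^ 2)) P) (hind : iIndepFun ξ P) :
    P.map (fun ω k => ξ none ω - ξ (some k) ω) =
      volume.withDensity fun e => ENNReal.ofReal (gaussDensity 0 (diffCov K τ) e) := by
  have hv : τ ^ 2 ≠ 0 := (pow_pos hτ 2).ne'
  have hpdf : Measurable (gaussianPDF 0 (τ ^ 2)) := measurable_gaussianPDF _ _
  have hlaw := hind.map_fun_eq_pi_map fun o => (hξm o).aemeasurable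
  simp_rw [fun o => (hξ o).map_eq] at hlaw
  have hpi : Measure.pi (fun _ : K => gaussianReal 0 (τ ^ 2)) =
      volume.withDensity fun x : K → ℝ => ∏ k, gaussianPDF 0 (τ ^ 2) (x k) := by
    have : SigmaFinite ((volume : Measure ℝ).withDensity (gaussianPDF 0 (τ ^ 2))) := by
      rw [← gaussianReal_of_var_ne_zero 0 hv]; infer_instance
    simp_rw [gaussianReal_of_var_ne_zero 0 hv]
    exact pi_withDensity (fun _ => volume) (fun _ => hpdf)
  have hprod : Measurable fun x : K → ℝ => ∏ k, gaussianPDF 0 (τ ^ 2) (x k) :=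
    Finset.measurable_prod _ fun k _ => hpdf.comp (measurable_pi_apply k)
  have hout : ∀ {f : ℝ → ENNReal}, Measurable f → ∫⁻ a, f a ∂gaussianReal 0 (τ ^ 2) =
      ∫⁻ a, gaussianPDF 0 (τ ^ 2) a * f a := fun hf => by
    rw [gaussianReal_of_var_ne_zero 0 hv, lintegral_withDensity_eq_lintegral_mul _ hpdf hf]
    rfl
  ext S hS
  have hg : Measurable fun q : (K → ℝ) × ℝ => fun k => q.2 - q.1 k := by fun_prop
  have hg' : Measurable fun x : Option K → ℝ => fun k => x none - x (some k) := by fun_prop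
  have hmap : P.map (fun ω k => ξ none ω - ξ (some k) ω) =
      ((Measure.pi fun _ : K => gaussianReal 0 (τ ^ 2)).prod (gaussianReal 0 (τ ^ 2))).map
        (fun q k => q.2 - q.1 k) := by
    have h1 : (fun ω k => ξ none ω - ξ (some k) ω) =
        (fun (x : Option K → ℝ) k => x none - x (some k)) ∘ fun ω o => ξ o ω := rfl
    rw [h1, ← Measure.map_map hg' (by fun_prop), hlaw,
      ← Measure.pi_map_piOptionEquivProd (fun _ : Option K => gaussianReal 0 (τ ^ 2)),
      Measure.map_map hg' (MeasurableEquiv.measurable _)]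
    rfl
  rw [hmap, Measure.map_apply hg hS, Measure.prod_apply_symm (hg hS), withDensity_apply _ hS,
    hout (measurable_measure_prodMk_right (hg hS))]
  have hinner : ∀ a : ℝ, Measure.pi (fun _ : K => gaussianReal 0 (τ ^ 2))
      ((fun x => (x, a)) ⁻¹' ((fun q : (K → ℝ) × ℝ => fun k => q.2 - q.1 k) ⁻¹' S)) =
      ∫⁻ e in S, ∏ k, gaussianPDF 0 (τ ^ 2) (a - e k) := by
    intro a
    have hset : MeasurableSet
        ((fun x => (x, a)) ⁻¹' ((fun q : (K → ℝ) × ℝ => fun k => q.2 - q.1 k) ⁻¹' S)) :=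
      measurable_prodMk_right (hg hS)
    rw [hpi, withDensity_apply _ hset, ← lintegral_indicator hset, ← lintegral_indicator hS,
      ← lintegral_sub_left_eq_self _ (fun _ : K => a)]
    refine lintegral_congr fun e => ?_
    have hiff : (fun _ => a) - e ∈
        (fun x => (x, a)) ⁻¹' ((fun q : (K → ℝ) × ℝ => fun k => q.2 - q.1 k) ⁻¹' S) ↔ e ∈ S := by
      change (fun k => a - (a - e k)) ∈ S ↔ _
      simp only [sub_sub_cancel]
    by_cases he : e ∈ S
    · rw [Set.indicator_of_mem (hiff.2 he), Set.indicator_of_mem he]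
      rfl
    · rw [Set.indicator_of_notMem (fun h => he (hiff.1 h)), Set.indicator_of_notMem he]
  simp_rw [hinner]
  have hjm : Measurable fun q : ℝ × (K → ℝ) => ∏ k, gaussianPDF 0 (τ ^ 2) (q.1 - q.2 k) :=
    Finset.measurable_prod _ fun k _ => hpdf.comp (by fun_prop)
  have hjm' : Measurable fun q : ℝ × (K → ℝ) =>
      gaussianPDF 0 (τ ^ 2) q.1 * ∏ k, gaussianPDF 0 (τ ^ 2) (q.1 - q.2 k) :=
    (hpdf.comp measurable_fst).mul hjm
  calc ∫⁻ a, gaussianPDF 0 (τ ^ 2) a * ∫⁻ e in S, ∏ k, gaussianPDF 0 (τ ^ 2) (a - e k)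
      = ∫⁻ a, ∫⁻ e in S, gaussianPDF 0 (τ ^ 2) a * ∏ k, gaussianPDF 0 (τ ^ 2) (a - e k) :=
        lintegral_congr fun a =>
          (lintegral_const_mul _ (hjm.comp measurable_prodMk_left)).symm
    _ = ∫⁻ e in S, ∫⁻ a, gaussianPDF 0 (τ ^ 2) a * ∏ k, gaussianPDF 0 (τ ^ 2) (a - e k) :=
        lintegral_lintegral_swap hjm'.aemeasurable
    _ = _ := lintegral_congr fun e => lintegral_gaussianPDF_mul_prod hτ e

end Noise

/-! ### The largest entries of a vector -/

section TopIdx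

variable {K : Type*} [Fintype K] [LinearOrder K]

/-- The number of entries of `D` below the entry `k`, ties being ordered by index. -/
def rank (D : K → ℝ) (k : K) : ℕ := by
  classical
  exact (Finset.univ.filter (fun j => D j < D k ∨ (D j = D k ∧ j < k))).card

theorem mem_topIdx {D : K → ℝ} {r : ℕ} {k : K} : k ∈ topIdx D r ↔ r ≤ rank D k := by
  simp [topIdx, rank]

theorem rank_lt_rank {D : K → ℝ} {j k : K} (h : D j < D k ∨ (D j = D k ∧ j < k)) :
    rank D j < rank D k := by
  classical
  refine Finset.card_lt_card (Finset.ssubset_iff_of_subset ?_ |>.2 ⟨j, by simpa using h, by simp⟩)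
  intro i hi
  simp only [Finset.mem_filter, Finset.mem_univ, true_and] at hi ⊢
  rcases h with h | ⟨h, hjk⟩ <;> rcases hi with hi | ⟨hi, hij⟩
  · exact Or.inl (hi.trans h)
  · exact Or.inl (hi ▸ h)
  · exact Or.inl (h ▸ hi)
  · exact Or.inr ⟨hi.trans h, hij.trans hjk⟩

theorem rank_injective (D : K → ℝ) : Function.Injective (rank D) := by
  intro j k hjk
  by_contra hne
  rcases lt_trichotomy (D j) (D k) with h | h | h
  · exact (rank_lt_rank (Or.inl h)).ne hjk
  · rcases lt_or_gt_of_ne hne with h' | h'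
    · exact (rank_lt_rank (Or.inr ⟨h, h'⟩)).ne hjk
    · exact (rank_lt_rank (Or.inr ⟨h.symm, h'⟩)).ne hjk.symm
  · exact (rank_lt_rank (Or.inl h)).ne hjk.symm

theorem rank_lt_card (D : K → ℝ) (k : K) : rank D k < Fintype.card K := by
  classical
  exact Finset.card_lt_univ_of_notMem (x := k) (by simp)

/-- The ranks of the entries are exactly `0, …, card K - 1`, so `card K - r` of them are at least
`r`. -/
theorem card_topIdx (D : K → ℝ) {r : ℕ} : (topIdx D r).card = Fintype.card K - r := by
  have huniv : Finset.univ.image (rank D) = Finset.range (Fintype.card K) := by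
    refine Finset.eq_of_subset_of_card_le ?_ ?_
    · intro i hi
      obtain ⟨k, -, rfl⟩ := Finset.mem_image.1 hi
      exact Finset.mem_range.2 (rank_lt_card D k)
    · rw [Finset.card_image_of_injective _ (rank_injective D), Finset.card_range, Finset.card_univ]
  have himg : (topIdx D r).image (rank D) = Finset.Ico r (Fintype.card K) := by
    ext i
    rw [Finset.mem_image, Finset.mem_Ico]
    constructor
    · rintro ⟨k, hk, rfl⟩
      exact ⟨mem_topIdx.1 hk, rank_lt_card D k⟩
    · rintro ⟨h1, h2⟩
      rw [← Finset.mem_range, ← huniv, Finset.mem_image] at h2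
      obtain ⟨k, -, rfl⟩ := h2
      exact ⟨k, mem_topIdx.2 h1, rfl⟩
  rw [← Finset.card_image_of_injective _ (rank_injective D), himg, Nat.card_Ico]

theorem card_compl_topIdx [DecidableEq K] (D : K → ℝ) {r : ℕ} (hr : r ≤ Fintype.card K) :
    ((topIdx D r)ᶜ).card = r := by
  rw [Finset.card_compl, card_topIdx]; omega

/-- In the absence of ties, the set of the largest entries is characterized without reference to the
order of the indices. -/
theorem topIdx_eq_iff {D : K → ℝ} (hD : Function.Injective D) {r : ℕ} (hr : r ≤ Fintype.card K)
    {I : Finset K} (hI : I.card = Fintype.card K - r) :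
    topIdx D r = I ↔ ∀ j ∉ I, ∀ k ∈ I, D j < D k := by
  classical
  constructor
  · rintro rfl j hj k hk
    rw [mem_topIdx] at hj hk
    by_contra hlt
    rcases (not_lt.1 hlt).lt_or_eq with h | h
    · exact absurd (rank_lt_rank (Or.inl h)) (by omega)
    · rw [hD h] at hk
      exact hj hk
  · intro h
    refine (Finset.eq_of_subset_of_card_le (fun k hk => ?_) (by rw [card_topIdx, hI])).symm
    rw [mem_topIdx]
    have hsub : Iᶜ ⊆ Finset.univ.filter (fun j => D j < D k ∨ (D j = D k ∧ j < k)) := fun j hj => by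
      simpa using Or.inl (h j (Finset.mem_compl.1 hj) k hk)
    have hcard := Finset.card_le_card hsub
    rw [Finset.card_compl, hI] at hcard
    have : rank D k = (Finset.univ.filter (fun j => D j < D k ∨ (D j = D k ∧ j < k))).card := by
      unfold rank; congr
    omega

theorem measurable_rank (k : K) : Measurable fun D : K → ℝ => rank D k := by
  classical
  have : (fun D : K → ℝ => rank D k) =
      fun D => ∑ j, if D j < D k ∨ (D j = D k ∧ j < k) then 1 else 0 := by
    funext D
    simp only [rank, Finset.card_filter]
  rw [this]
  refine Finset.measurable_sum _ fun j _ => Measurable.ite ?_ measurable_const measurable_const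
  refine (measurableSet_lt (measurable_pi_apply j) (measurable_pi_apply k)).union ?_
  exact (measurableSet_eq_fun (measurable_pi_apply j) (measurable_pi_apply k)).inter
    (MeasurableSet.const _)

theorem measurableSet_mem_topIdx (k : K) (r : ℕ) : MeasurableSet {D : K → ℝ | k ∈ topIdx D r} := by
  simp_rw [mem_topIdx]
  exact measurableSet_le measurable_const (measurable_rank k)

theorem measurableSet_topIdx_eq (r : ℕ) (I : Finset K) :
    MeasurableSet {D : K → ℝ | topIdx D r = I} := by
  have : {D : K → ℝ | topIdx D r = I} = ⋂ k, {D | k ∈ topIdx D r ↔ k ∈ I} := by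
    ext D; simp [Finset.ext_iff]
  rw [this]
  refine MeasurableSet.iInter fun k => ?_
  by_cases hk : k ∈ I
  · simpa [hk] using measurableSet_mem_topIdx k r
  · simp only [hk, iff_false]
    exact (measurableSet_mem_topIdx k r).compl

end TopIdx

/-! ### Null sets of ties -/

section Ties

variable {K : Type*} [Fintype K]

theorem ae_injective : ∀ᵐ D : K → ℝ, Function.Injective D := by
  classical
  have h : ∀ j k : K, j ≠ k → ∀ᵐ D : K → ℝ, D j ≠ D k := by
    intro j k hjk
    let φ : (K → ℝ) →ₗ[ℝ] ℝ := LinearMap.proj (R := ℝ) (φ := fun _ => ℝ) j -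
      LinearMap.proj (R := ℝ) (φ := fun _ => ℝ) k
    have hne : LinearMap.ker φ ≠ ⊤ := by
      intro htop
      have hmem : Pi.single j (1 : ℝ) ∈ LinearMap.ker φ := htop ▸ Submodule.mem_top
      simp [φ, hjk.symm] at hmem
    have hnull := Measure.addHaar_submodule (volume : Measure (K → ℝ)) (LinearMap.ker φ) hne
    refine measure_mono_null (fun D hD => ?_) hnull
    have : D j = D k := by simpa using hD
    simp [φ, this]
  have h' : ∀ᵐ D : K → ℝ, ∀ j k : K, j ≠ k → D j ≠ D k := by
    rw [ae_all_iff]; intro j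
    rw [ae_all_iff]; intro k
    by_cases hjk : j = k
    · simp [hjk]
    · filter_upwards [h j k hjk] with D hD _ using hD
  filter_upwards [h'] with D hD j k hjk
  by_contra hne
  exact hD j k hne hjk

end Ties

/-! ### The conditioned information and its image measure -/

section Info

variable {K : Type*} [Fintype K] [DecidableEq K]

/-- The code of a set `I` of indices together with the entries `d` at these indices: the membership
in `I` and the entry (set to `0` outside `I`) of each index.  All `I` share this codomain. -/
def encode (I : Finset K) (d : I → ℝ) : K → Prop × ℝ :=
  fun k => (k ∈ I, if hk : k ∈ I then d ⟨k, hk⟩ else 0)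

open Classical in
/-- The set of indices recorded by a code. -/
def codeIdx (a : K → Prop × ℝ) : Finset K := Finset.univ.filter fun k => (a k).1

/-- The factor of the correction as a function of the code of the conditioned data. -/
def gammaCode (Ω : Matrix K K ℝ) (β : K → ℝ) (a : K → Prop × ℝ) : ℝ :=
  gammaFactor Ω β (codeIdx a) fun k => (a k).2

theorem codeIdx_encode (I : Finset K) (d : I → ℝ) : codeIdx (encode I d) = I := by
  classical
  ext k
  rw [codeIdx, Finset.mem_filter]
  simp [encode]

theorem gammaFactor_congr (Ω : Matrix K K ℝ) (β : K → ℝ) {I J : Finset K} (hIJ : I = J)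
    {v w : K → ℝ} (hvw : ∀ k ∈ I, v k = w k) :
    gammaFactor Ω β I (fun k => v k) = gammaFactor Ω β J (fun k => w k) := by
  subst hIJ
  congr 1
  funext k
  exact hvw k k.2

theorem gammaCode_encode (Ω : Matrix K K ℝ) (β : K → ℝ) (I : Finset K) (d : I → ℝ) :
    gammaCode Ω β (encode I d) = gammaFactor Ω β I d := by
  refine (gammaFactor_congr Ω β (codeIdx_encode I d) (v := fun k => (encode I d k).2)
    (w := fun k => if hk : k ∈ I then d ⟨k, hk⟩ else 0) fun k _ => rfl).trans ?_
  congr 1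
  funext k
  simp

theorem measurable_encode {K : Type*} [DecidableEq K] (I : Finset K) : Measurable (encode I) := by
  refine measurable_pi_lambda _ fun k => ?_
  unfold encode
  by_cases hk : k ∈ I
  · simp only [hk, dite_true]; fun_prop
  · simp only [hk, dite_false]; fun_prop

theorem measurableEmbedding_encode (I : Finset K) : MeasurableEmbedding (encode I) := by
  refine MeasurableEmbedding.of_measurable_inverse (g := fun a k => (a k).2)
    (measurable_encode I) ?_ (by fun_prop) ?_
  · have hrange : Set.range (encode I) =
        ⋂ k, ({a | (a k).1 = (k ∈ I)} ∩ {a | k ∉ I → (a k).2 = 0}) := by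
      ext a
      simp only [Set.mem_range, Set.mem_iInter, Set.mem_inter_iff, Set.mem_ofPred_eq]
      constructor
      · rintro ⟨d, rfl⟩ k
        exact ⟨rfl, fun hk => by simp [encode, hk]⟩
      · intro h
        refine ⟨fun k => (a k).2, ?_⟩
        funext k
        refine Prod.ext (h k).1.symm ?_
        by_cases hk : k ∈ I
        · simp [encode, hk]
        · simp [encode, hk, (h k).2 hk]
    rw [hrange]
    refine MeasurableSet.iInter fun k => MeasurableSet.inter ?_ ?_
    · exact (measurable_fst.comp (measurable_pi_apply k)) (measurableSet_singleton _)
    · by_cases hk : k ∈ I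
      · simp [hk]
      · have hm : Measurable fun a : K → Prop × ℝ => (a k).2 := by fun_prop
        simp only [hk, not_false_eq_true, forall_const]
        exact hm (measurableSet_singleton 0)
  · intro d
    funext k
    simp [encode]

theorem measurableSet_codeIdx_eq {K : Type*} [Fintype K] (I : Finset K) :
    MeasurableSet {a : K → Prop × ℝ | codeIdx a = I} := by
  have : {a : K → Prop × ℝ | codeIdx a = I} = ⋂ k, {a | (a k).1 = (k ∈ I)} := by
    ext a; simp [codeIdx, Finset.ext_iff]
  rw [this]
  exact MeasurableSet.iInter fun k =>
    (measurable_fst.comp (measurable_pi_apply k)) (measurableSet_singleton _)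

/-- Lebesgue measure on the codes of positive values at `card K - r` indices; it dominates the laws
of the conditioned data on the selection event. -/
def codeMeasure (K : Type*) [Fintype K] [DecidableEq K] (r : ℕ) : Measure (K → Prop × ℝ) :=
  Measure.sum fun I : {I : Finset K // I.card = Fintype.card K - r} =>
    ((volume : Measure (I.1 → ℝ)).restrict {d | ∀ k, 0 < d k}).map (encode I.1)

instance (r : ℕ) : SigmaFinite (codeMeasure K r) := by
  have : ∀ I : {I : Finset K // I.card = Fintype.card K - r}, SigmaFinite
      (((volume : Measure (I.1 → ℝ)).restrict {d | ∀ k, 0 < d k}).map (encode I.1)) :=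
    fun I => (measurableEmbedding_encode I.1).sigmaFinite_map
  unfold codeMeasure
  infer_instance

theorem lt_minVal_iff {K : Type*} {I : Finset K} {d : I → ℝ} {x : ℝ} :
    (x : EReal) < minVal I d ↔ ∀ k, x < d k := by
  unfold minVal
  constructor
  · intro h k
    exact EReal.coe_lt_coe_iff.1 (h.trans_le (iInf_le _ k))
  · intro h
    rcases isEmpty_or_nonempty I with hI | hI
    · rw [iInf_of_empty]; exact EReal.coe_lt_top x
    · obtain ⟨k, hk⟩ := exists_eq_ciInf_of_finite (f := fun k : I => (d k : EReal))
      rw [← hk]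
      exact EReal.coe_lt_coe_iff.2 (h k)

theorem mem_box {I : Finset K} {d : I → ℝ} {u : ↥Iᶜ → ℝ} :
    u ∈ box I d ↔ ∀ k, 0 < u k ∧ ∀ i, u k < d i := by
  simp only [box, Set.mem_ofPred_eq, lt_minVal_iff]

theorem measurableSet_box_graph (I : Finset K) :
    MeasurableSet {q : (I → ℝ) × (↥Iᶜ → ℝ) | q.2 ∈ box I q.1} := by
  simp_rw [mem_box, Set.ofPred_forall, Set.ofPred_and, Set.ofPred_forall]
  refine MeasurableSet.iInter fun k => (measurableSet_lt (by fun_prop) (by fun_prop)).inter ?_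
  exact MeasurableSet.iInter fun i => measurableSet_lt (by fun_prop) (by fun_prop)

theorem measurableSet_box (I : Finset K) (d : I → ℝ) : MeasurableSet (box I d) :=
  measurable_prodMk_left (measurableSet_box_graph I)

theorem measurePreserving_split (I : Finset K) :
    MeasurePreserving (fun D : K → ℝ => ((fun k : I => D k), (fun k : ↥Iᶜ => D k)))
      volume (volume.prod volume) :=
  (volume_measurePreserving_sumPiEquivProdPi (fun _ : ↥I ⊕ ↥Iᶜ => ℝ)).comp
    (volume_measurePreserving_piCongrLeft (fun _ : K => ℝ) (sumComplEquiv I)).symm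

theorem lintegral_split (I : Finset K) {f : (I → ℝ) × (↥Iᶜ → ℝ) → ENNReal} (hf : Measurable f) :
    ∫⁻ D : K → ℝ, f ((fun k : I => D k), (fun k : ↥Iᶜ => D k)) = ∫⁻ d, ∫⁻ u, f (d, u) := by
  rw [(measurePreserving_split I).lintegral_comp hf, lintegral_prod _ hf.aemeasurable]

end Info

/-! ### The factor of the correction as a density -/

section GammaFactor

variable {K : Type*} [Fintype K] [DecidableEq K]

theorem measurable_gaussDensity_left (m : K → ℝ) (C : Matrix K K ℝ) :
    Measurable fun u => gaussDensity m C u :=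
  ((continuous_gaussDensity C).comp (by fun_prop : Continuous fun u : K → ℝ => (m, u))).measurable

theorem lintegral_gaussDensity_eq (m : K → ℝ) (C : Matrix K K ℝ) :
    ∫⁻ u, ENNReal.ofReal (gaussDensity m C u) = ∫⁻ u, ENNReal.ofReal (gaussDensity 0 C u) := by
  simp_rw [gaussDensity_eq_sub m]
  exact lintegral_sub_right_eq_self (fun u => ENNReal.ofReal (gaussDensity 0 C u)) m

theorem lintegral_gaussDensity_diffCov {τ : ℝ≥0} (hτ : 0 < τ) (β : K → ℝ) :
    ∫⁻ u, ENNReal.ofReal (gaussDensity β (diffCov K τ) u) = 1 := by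
  have h := map_sub_eq_withDensity (K := K) hτ
    (P := Measure.pi fun _ : Option K => gaussianReal 0 (τ ^ 2)) (ξ := fun o x => x o)
    (fun o => measurable_pi_apply o)
    (fun o => (measurePreserving_eval (fun _ => gaussianReal 0 (τ ^ 2)) o).hasLaw)
    (iIndepFun_pi (X := fun _ => id) fun _ => aemeasurable_id)
  have hprob : IsProbabilityMeasure ((Measure.pi fun _ : Option K => gaussianReal 0 (τ ^ 2)).map
      (fun x k => x none - x (some k))) :=
    Measure.isProbabilityMeasure_map (by fun_prop)
  rw [lintegral_gaussDensity_eq, ← setLIntegral_univ, ← withDensity_apply _ MeasurableSet.univ, ← h]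
  exact hprob.measure_univ

@[fun_prop]
theorem continuous_condMean (Ω : Matrix K K ℝ) (I : Finset K) :
    Continuous fun q : (K → ℝ) × (I → ℝ) => condMean Ω q.1 I q.2 := by
  unfold condMean; fun_prop

@[fun_prop]
theorem continuous_topDensity {K : Type*} [DecidableEq K] (Ω : Matrix K K ℝ) (I : Finset K) :
    Continuous fun q : (K → ℝ) × (I → ℝ) => topDensity Ω q.1 I q.2 := by
  unfold topDensity
  exact (continuous_gaussDensity _).comp
    (by fun_prop : Continuous fun q : (K → ℝ) × (I → ℝ) => ((fun k : I => q.1 k), q.2))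

theorem continuous_condDensity (Ω : Matrix K K ℝ) (I : Finset K) :
    Continuous fun q : ((K → ℝ) × (I → ℝ)) × (↥Iᶜ → ℝ) =>
      gaussDensity (condMean Ω q.1.1 I q.1.2) (condCov Ω I) q.2 :=
  (continuous_gaussDensity _).comp
    (((continuous_condMean Ω I).comp continuous_fst).prodMk continuous_snd)

theorem topDensity_pos {K : Type*} [DecidableEq K] {Ω : Matrix K K ℝ} (hΩ : Ω.PosDef)
    (β : K → ℝ) (I : Finset K) (d : I → ℝ) : 0 < topDensity Ω β I d :=
  gaussDensity_pos (hΩ.submatrix Subtype.val_injective) _ _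

/-- The total mass of the conditional density does not depend on the conditional mean, and times
the mass of the marginal density it is that of the full density; so it is finite. -/
theorem lintegral_condDensity_ne_top {τ : ℝ≥0} (hτ : 0 < τ) (I : Finset K) :
    ∫⁻ u, ENNReal.ofReal (gaussDensity 0 (condCov (diffCov K τ) I) u) ≠ ⊤ := by
  set Ω := diffCov K τ with hΩdef
  have hΩ : Ω.PosDef := posDef_diffCov hτ
  set c := ∫⁻ u, ENNReal.ofReal (gaussDensity 0 (condCov Ω I) u) with hc
  have hmeas : Measurable fun q : (I → ℝ) × (↥Iᶜ → ℝ) => ENNReal.ofReal (topDensity Ω 0 I q.1 *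
      gaussDensity (condMean Ω 0 I q.1) (condCov Ω I) q.2) := by
    refine (Continuous.mul ?_ ?_).measurable.ennreal_ofReal
    · exact (continuous_topDensity Ω I).comp (by fun_prop : Continuous
        fun q : (I → ℝ) × (↥Iᶜ → ℝ) => ((0 : K → ℝ), q.1))
    · exact (continuous_condDensity Ω I).comp (by fun_prop : Continuous
        fun q : (I → ℝ) × (↥Iᶜ → ℝ) => (((0 : K → ℝ), q.1), q.2))
  have h1 : (∫⁻ d : I → ℝ, ENNReal.ofReal (topDensity Ω 0 I d)) * c = 1 := by
    rw [← lintegral_gaussDensity_diffCov hτ (0 : K → ℝ)]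
    simp_rw [← hΩdef, gaussDensity_eq_topDensity_mul hΩ 0 I]
    rw [lintegral_split I hmeas, ← lintegral_mul_const]
    · refine lintegral_congr fun d => ?_
      simp_rw [ENNReal.ofReal_mul (topDensity_pos hΩ 0 I d).le]
      rw [lintegral_const_mul _ (measurable_gaussDensity_left _ _).ennreal_ofReal,
        lintegral_gaussDensity_eq]
    · exact (measurable_gaussDensity_left _ _).ennreal_ofReal
  intro htop
  rw [htop] at h1
  have h0 : ∫⁻ d : I → ℝ, ENNReal.ofReal (topDensity Ω 0 I d) ≠ 0 := by
    intro h0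
    simp [h0] at h1
  rw [ENNReal.mul_top h0] at h1
  exact ENNReal.top_ne_one h1

theorem integrable_condDensity {τ : ℝ≥0} (hτ : 0 < τ) (I : Finset K) (m : ↥Iᶜ → ℝ) :
    Integrable (fun u => gaussDensity m (condCov (diffCov K τ) I) u) := by
  refine ⟨(measurable_gaussDensity_left _ _).aestronglyMeasurable, ?_⟩
  rw [hasFiniteIntegral_iff_ofReal (Filter.Eventually.of_forall fun u => gaussDensity_nonneg _ _ _),
    lintegral_gaussDensity_eq]
  exact (lintegral_condDensity_ne_top hτ I).lt_top

theorem gammaFactor_nonneg {τ : ℝ≥0} (hτ : 0 < τ) (β : K → ℝ) (I : Finset K) (d : I → ℝ) :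
    0 ≤ gammaFactor (diffCov K τ) β I d :=
  mul_nonneg (topDensity_pos (posDef_diffCov hτ) β I d).le
    (integral_nonneg fun _ => gaussDensity_nonneg _ _ _)

theorem ofReal_gammaFactor {τ : ℝ≥0} (hτ : 0 < τ) (β : K → ℝ) (I : Finset K) (d : I → ℝ) :
    ENNReal.ofReal (gammaFactor (diffCov K τ) β I d) =
      ENNReal.ofReal (topDensity (diffCov K τ) β I d) * ∫⁻ u in box I d,
        ENNReal.ofReal
          (gaussDensity (condMean (diffCov K τ) β I d) (condCov (diffCov K τ) I) u) := by
  rw [gammaFactor, ENNReal.ofReal_mul (topDensity_pos (posDef_diffCov hτ) β I d).le,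
    ofReal_integral_eq_lintegral_ofReal (integrable_condDensity hτ I _).integrableOn
      (Filter.Eventually.of_forall fun u => gaussDensity_nonneg _ _ _)]

/-- For fixed conditioned data the factor is bounded in the gains. -/
theorem exists_gammaFactor_le {τ : ℝ≥0} (hτ : 0 < τ) (I : Finset K) (d : I → ℝ) :
    ∃ C : ℝ, ∀ β : K → ℝ, gammaFactor (diffCov K τ) β I d ≤ C := by
  refine ⟨(√((2 * Real.pi) ^ Fintype.card I * ((diffCov K τ).submatrix
      (fun k : I => (k : K)) (fun k : I => (k : K))).det))⁻¹ *
    (∫⁻ u, ENNReal.ofReal (gaussDensity 0 (condCov (diffCov K τ) I) u)).toReal, fun β => ?_⟩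
  refine mul_le_mul
    (gaussDensity_le ((posDef_diffCov hτ).submatrix Subtype.val_injective) _ _) ?_
    (integral_nonneg fun _ => gaussDensity_nonneg _ _ _) (by positivity)
  refine (setIntegral_le_integral (integrable_condDensity hτ I _)
    (Filter.Eventually.of_forall fun u => gaussDensity_nonneg _ _ _)).trans_eq ?_
  rw [integral_eq_lintegral_of_nonneg_ae
    (Filter.Eventually.of_forall fun u => gaussDensity_nonneg _ _ _)
    (measurable_gaussDensity_left _ _).aestronglyMeasurable, lintegral_gaussDensity_eq]

theorem measurable_gammaFactor (Ω : Matrix K K ℝ) (I : Finset K) :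
    Measurable fun q : (K → ℝ) × (I → ℝ) => gammaFactor Ω q.1 I q.2 := by
  refine (continuous_topDensity Ω I).measurable.mul ?_
  have hind : ∀ q : (K → ℝ) × (I → ℝ),
      ∫ u in box I q.2, gaussDensity (condMean Ω q.1 I q.2) (condCov Ω I) u =
      ∫ u, {p : ((K → ℝ) × (I → ℝ)) × (↥Iᶜ → ℝ) | p.2 ∈ box I p.1.2}.indicator
        (fun p => gaussDensity (condMean Ω p.1.1 I p.1.2) (condCov Ω I) p.2) (q, u) := by
    intro q
    rw [← integral_indicator (measurableSet_box I q.2)]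
    rfl
  simp_rw [hind]
  have hset : MeasurableSet {p : ((K → ℝ) × (I → ℝ)) × (↥Iᶜ → ℝ) | p.2 ∈ box I p.1.2} :=
    (by fun_prop : Measurable fun p : ((K → ℝ) × (I → ℝ)) × (↥Iᶜ → ℝ) => (p.1.2, p.2))
      (measurableSet_box_graph I)
  exact ((continuous_condDensity Ω I).measurable.indicator
    hset).stronglyMeasurable.integral_prod_right'.measurable

/-- On the finitely many sets of codes with a given index set, `gammaCode` is a `gammaFactor`. -/
theorem measurable_gammaCode (Ω : Matrix K K ℝ) :
    Measurable fun q : (K → ℝ) × (K → Prop × ℝ) => gammaCode Ω q.1 q.2 := by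
  have hmI : ∀ I : Finset K, Measurable fun q : (K → ℝ) × (K → Prop × ℝ) =>
      gammaFactor Ω q.1 I fun k => (q.2 k).2 := fun I => by
    have hm : Measurable fun q : (K → ℝ) × (K → Prop × ℝ) => (q.1, fun k : I => (q.2 k).2) := by
      fun_prop
    have hc := (measurable_gammaFactor Ω I).comp hm
    exact hc
  have hsum : (fun q : (K → ℝ) × (K → Prop × ℝ) => gammaCode Ω q.1 q.2) =
      fun q => ∑ I : Finset K, {q : (K → ℝ) × (K → Prop × ℝ) | codeIdx q.2 = I}.indicator
        (fun q => gammaFactor Ω q.1 I fun k => (q.2 k).2) q := by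
    funext q
    rw [Finset.sum_eq_single (codeIdx q.2)]
    · rw [Set.indicator_of_mem (by rfl)]; rfl
    · exact fun I _ hI => Set.indicator_of_notMem
        (s := {q : (K → ℝ) × (K → Prop × ℝ) | codeIdx q.2 = I}) (fun h => hI (Eq.symm h)) _
    · exact fun h => absurd (Finset.mem_univ _) h
  rw [hsum]
  refine Finset.measurable_sum _ fun I _ => Measurable.indicator ?_ ?_
  · exact hmI I
  · have hm : Measurable fun q : (K → ℝ) × (K → Prop × ℝ) => q.2 := measurable_snd
    exact hm (measurableSet_codeIdx_eq I)

theorem gammaCode_nonneg {τ : ℝ≥0} (hτ : 0 < τ) (β : K → ℝ) (a : K → Prop × ℝ) :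
    0 ≤ gammaCode (diffCov K τ) β a := gammaFactor_nonneg hτ _ _ _

end GammaFactor

section TopCode

variable {K : Type*} [Fintype K] [LinearOrder K]

/-- The code of the indices and the values of the `card K - r` largest entries of `D`. -/
def topCode (r : ℕ) (D : K → ℝ) : K → Prop × ℝ :=
  fun k => (k ∈ topIdx D r, (topIdx D r : Set K).indicator D k)

theorem measurable_topCode (r : ℕ) : Measurable (topCode r : (K → ℝ) → K → Prop × ℝ) := by
  refine measurable_pi_lambda _ fun k => Measurable.prodMk ?_ ?_
  · exact measurableSet_setOfPred.1 (measurableSet_mem_topIdx k r)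
  · classical
    simp only [Set.indicator, SetLike.mem_coe]
    exact Measurable.ite (measurableSet_mem_topIdx k r) (measurable_pi_apply k) measurable_const

theorem codeIdx_topCode (r : ℕ) (D : K → ℝ) : codeIdx (topCode r D) = topIdx D r := by
  classical
  ext k
  rw [codeIdx, Finset.mem_filter]
  simp [topCode]

variable [DecidableEq K]

theorem topCode_eq_encode {r : ℕ} {D : K → ℝ} {I : Finset K} (h : topIdx D r = I) :
    topCode r D = encode I fun k => D k := by
  subst h
  funext k
  by_cases hk : k ∈ topIdx D r <;> simp [topCode, encode, hk]

theorem gammaCode_topCode (Ω : Matrix K K ℝ) (β : K → ℝ) (r : ℕ) (D : K → ℝ) :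
    gammaCode Ω β (topCode r D) = gammaFactor Ω β (topIdx D r) fun k => D k :=
  gammaFactor_congr Ω β (codeIdx_topCode r D) (v := fun k => (topCode r D k).2) fun k hk => by
    rw [codeIdx_topCode] at hk
    simp [topCode, hk]

/-- Restricted to positive vectors, the Gaussian law with mean `β` has, for the conditioned data,
the factor of the correction as its density.  The coordinates outside `I` are integrated out: given
that `I` indexes the largest entries, they range over the box below the smallest of these. -/
theorem lintegral_pos_gaussDensity {τ : ℝ≥0} (hτ : 0 < τ) {r : ℕ} (hr : r ≤ Fintype.card K)
    (β : K → ℝ) {H : (K → Prop × ℝ) → ENNReal} (hH : Measurable H) :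
    ∫⁻ D in {D : K → ℝ | ∀ k, 0 < D k},
        H (topCode r D) * ENNReal.ofReal (gaussDensity β (diffCov K τ) D) =
      ∫⁻ a, H a * ENNReal.ofReal (gammaCode (diffCov K τ) β a) ∂codeMeasure K r := by
  set Ω := diffCov K τ with hΩdef
  have hΩ : Ω.PosDef := posDef_diffCov hτ
  have hpos : ∀ J : Type _, ∀ [Fintype J], MeasurableSet {D : J → ℝ | ∀ k, 0 < D k} := by
    intro J _
    rw [Set.ofPred_forall]
    exact MeasurableSet.iInter fun k => measurableSet_lt measurable_const (measurable_pi_apply k)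
  let 𝓘 := {I : Finset K // I.card = Fintype.card K - r}
  have hunion : {D : K → ℝ | ∀ k, 0 < D k} =
      ⋃ I : 𝓘, ({D : K → ℝ | ∀ k, 0 < D k} ∩ {D | topIdx D r = I.1}) := by
    ext D
    simp only [Set.mem_iUnion, Set.mem_inter_iff, Set.mem_ofPred_eq]
    exact ⟨fun h => ⟨⟨topIdx D r, card_topIdx D⟩, h, rfl⟩, fun ⟨_, h, _⟩ => h⟩
  rw [hunion, lintegral_iUnion
    (s := fun I : 𝓘 => {D : K → ℝ | ∀ k, 0 < D k} ∩ {D | topIdx D r = I.1})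
    (fun I => (hpos K).inter (measurableSet_topIdx_eq r I.1)) ?disj]
  case disj =>
    intro I J hIJ
    refine Set.disjoint_left.2 fun D hI hJ => hIJ (Subtype.ext ?_)
    exact hI.2.symm.trans hJ.2
  have hmγ : Measurable fun a => ENNReal.ofReal (gammaCode Ω β a) :=
    ((measurable_gammaCode Ω).comp measurable_prodMk_left).ennreal_ofReal
  rw [codeMeasure, lintegral_sum_measure]
  refine tsum_congr fun ⟨I, hI⟩ => ?_
  have hHγ : Measurable fun a => H a * ENNReal.ofReal (gammaCode Ω β a) := hH.mul hmγ
  rw [lintegral_map hHγ (measurable_encode I)]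
  simp only [gammaCode_encode]
  set S : Set ((I → ℝ) × (↥Iᶜ → ℝ)) := {q | (∀ k, 0 < q.1 k) ∧ q.2 ∈ box I q.1} with hS
  have hSm : MeasurableSet S := (measurable_fst (hpos I)).inter (measurableSet_box_graph I)
  set f : (I → ℝ) × (↥Iᶜ → ℝ) → ENNReal := fun q => H (encode I q.1) *
    ENNReal.ofReal (topDensity Ω β I q.1 *
      gaussDensity (condMean Ω β I q.1) (condCov Ω I) q.2) with hf
  have hfm : Measurable f := by
    refine (hH.comp ((measurable_encode I).comp measurable_fst)).mul ?_
    refine (Continuous.mul ?_ ?_).measurable.ennreal_ofReal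
    · exact (continuous_topDensity Ω I).comp (by fun_prop : Continuous
        fun q : (I → ℝ) × (↥Iᶜ → ℝ) => (β, q.1))
    · exact (continuous_condDensity Ω I).comp (by fun_prop : Continuous
        fun q : (I → ℝ) × (↥Iᶜ → ℝ) => ((β, q.1), q.2))
  have hLm : MeasurableSet ({D : K → ℝ | ∀ k, 0 < D k} ∩ {D | topIdx D r = I}) :=
    (hpos K).inter (measurableSet_topIdx_eq r I)
  calc ∫⁻ D in {D : K → ℝ | ∀ k, 0 < D k} ∩ {D | topIdx D r = I},
        H (topCode r D) * ENNReal.ofReal (gaussDensity β Ω D)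
      = ∫⁻ D : K → ℝ, S.indicator f ((fun k : I => D k), (fun k : ↥Iᶜ => D k)) := by
        rw [← lintegral_indicator hLm]
        refine lintegral_congr_ae ?_
        -- where the entries are distinct, positivity and the choice of `I` amount to the box
        filter_upwards [ae_injective (K := K)] with D hD
        have hiff : D ∈ {D : K → ℝ | ∀ k, 0 < D k} ∩ {D | topIdx D r = I} ↔
            ((fun k : I => D k), (fun k : ↥Iᶜ => D k)) ∈ S := by
          simp only [hS, Set.mem_inter_iff, Set.mem_ofPred_eq, mem_box, Subtype.forall,
            Finset.mem_compl, topIdx_eq_iff hD hr hI]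
          constructor
          · exact fun h => ⟨fun k _ => h.1 k, fun j hj => ⟨h.1 j, fun k hk => h.2 j hj k hk⟩⟩
          · refine fun h => ⟨fun k => ?_, fun j hj k hk => (h.2 j hj).2 k hk⟩
            by_cases hk : k ∈ I
            · exact h.1 k hk
            · exact (h.2 k hk).1
        by_cases hDS : D ∈ {D : K → ℝ | ∀ k, 0 < D k} ∩ {D | topIdx D r = I}
        · rw [Set.indicator_of_mem hDS, Set.indicator_of_mem (hiff.1 hDS),
            topCode_eq_encode hDS.2, gaussDensity_eq_topDensity_mul hΩ β I D]
        · rw [Set.indicator_of_notMem hDS, Set.indicator_of_notMem fun h => hDS (hiff.2 h)]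
    _ = ∫⁻ d, ∫⁻ u, S.indicator f (d, u) := lintegral_split I (hfm.indicator hSm)
    _ = ∫⁻ d in {d : I → ℝ | ∀ k, 0 < d k}, H (encode I d) *
          ENNReal.ofReal (gammaFactor Ω β I d) := by
        rw [← lintegral_indicator (hpos I)]
        refine lintegral_congr fun d => ?_
        by_cases hd : d ∈ {d : I → ℝ | ∀ k, 0 < d k}
        · rw [Set.indicator_of_mem hd, hΩdef, ofReal_gammaFactor hτ, ← hΩdef,
            ← lintegral_const_mul _ (measurable_gaussDensity_left _ _).ennreal_ofReal,
            ← lintegral_const_mul _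
              ((measurable_gaussDensity_left _ _).ennreal_ofReal.const_mul _),
            ← lintegral_indicator (measurableSet_box I d)]
          refine lintegral_congr fun u => ?_
          by_cases hu : u ∈ box I d
          · rw [Set.indicator_of_mem hu, Set.indicator_of_mem (show (d, u) ∈ S from ⟨hd, hu⟩), hf]
            simp only
            rw [ENNReal.ofReal_mul (topDensity_pos hΩ β I d).le]
          · rw [Set.indicator_of_notMem hu, Set.indicator_of_notMem fun h => hu h.2]
        · rw [Set.indicator_of_notMem hd]
          simp [Set.indicator_of_notMem fun h : (d, _) ∈ S => hd h.1]

end TopCode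

/-! ### The probability integral transform -/

theorem continuous_cdf (ρ : Measure ℝ) [IsProbabilityMeasure ρ] [NullSingletonClass ρ] :
    Continuous (cdf ρ) := by
  rw [continuous_iff_continuousAt]
  intro x
  rw [(monotone_cdf ρ).continuousAt_iff_leftLim_eq_rightLim, StieltjesFunction.rightLim_eq]
  have h := (cdf ρ).measure_singleton x
  rw [measure_cdf, measure_singleton] at h
  exact le_antisymm ((monotone_cdf ρ).leftLim_le le_rfl)
    (sub_nonpos.1 (ENNReal.ofReal_eq_zero.1 h.symm))

/-- A distribution function without jumps turns its own law into the uniform law. -/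
theorem map_cdf (ρ : Measure ℝ) [IsProbabilityMeasure ρ] [NullSingletonClass ρ] :
    ρ.map (cdf ρ) = volume.restrict (Set.Ioo (0 : ℝ) 1) := by
  have hm : Measurable (cdf ρ) := (monotone_cdf ρ).measurable
  have hprob : IsProbabilityMeasure (ρ.map (cdf ρ)) :=
    Measure.isProbabilityMeasure_map hm.aemeasurable
  refine Measure.ext_of_Iic _ _ fun x => ?_
  rw [Measure.map_apply hm measurableSet_Iic, Measure.restrict_apply measurableSet_Iic]
  rcases le_or_gt 1 x with hx1 | hx1
  · have h1 : cdf ρ ⁻¹' Set.Iic x = Set.univ :=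
      Set.eq_univ_of_forall fun t => (cdf_le_one ρ t).trans hx1
    have h2 : Set.Iic x ∩ Set.Ioo (0 : ℝ) 1 = Set.Ioo 0 1 :=
      Set.inter_eq_right.2 fun t ht => ht.2.le.trans hx1
    rw [h1, h2]
    simp
  · have h2 : Set.Iic x ∩ Set.Ioo (0 : ℝ) 1 = Set.Ioc 0 x := by
      ext t
      simp only [Set.mem_inter_iff, Set.mem_Iic, Set.mem_Ioo, Set.mem_Ioc]
      exact ⟨fun h => ⟨h.2.1, h.1⟩, fun h => ⟨h.2, h.1, h.2.trans_lt hx1⟩⟩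
    rw [h2, Real.volume_Ioc, sub_zero]
    set A := cdf ρ ⁻¹' Set.Iic x with hA
    have hclosed : IsClosed A := isClosed_Iic.preimage (continuous_cdf ρ)
    obtain ⟨b, hb⟩ : ∃ b, x < cdf ρ b :=
      ((tendsto_cdf_atTop ρ).eventually (lt_mem_nhds hx1)).exists
    have hbdd : BddAbove A := ⟨b, fun t ht => by
      by_contra hlt
      exact absurd (((monotone_cdf ρ) (not_le.1 hlt).le).trans ht) (not_le.2 hb)⟩
    rcases A.eq_empty_or_nonempty with hempty | hne
    · -- the distribution function tends to `0`, so an empty sublevel set forces `x ≤ 0`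
      have hx0 : x ≤ 0 := by
        by_contra hpos
        obtain ⟨t, ht⟩ :=
          ((tendsto_cdf_atBot ρ).eventually (gt_mem_nhds (not_le.1 hpos))).exists
        exact (hempty ▸ (show t ∈ A from ht.le) : t ∈ (∅ : Set ℝ))
      rw [hempty, measure_empty, ENNReal.ofReal_of_nonpos hx0]
    · have hmem : sSup A ∈ A := hclosed.csSup_mem hne hbdd
      have hIic : A = Set.Iic (sSup A) := Set.Subset.antisymm (fun t ht => le_csSup hbdd ht)
        fun t ht => ((monotone_cdf ρ) ht).trans hmem
      have hval : cdf ρ (sSup A) = x := by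
        refine le_antisymm hmem ?_
        by_contra hlt
        obtain ⟨t, ht1, ht2⟩ := (((continuous_cdf ρ).continuousAt.eventually
          (gt_mem_nhds (not_le.1 hlt))).filter_mono nhdsWithin_le_nhds |>.and
            (self_mem_nhdsWithin : Set.Ioi (sSup A) ∈ nhdsWithin _ _)).exists
        exact absurd (le_csSup hbdd (show t ∈ A from ht1.le)) (not_le.2 ht2)
      rw [hIic, ← ofReal_cdf, hval]

/-- The probability integral transform for an unnormalized density; both sides vanish if the total
mass does, so that no positivity is needed. -/
theorem setLIntegral_probabilityIntegralTransform {f : ℝ → ℝ} (hf0 : ∀ t, 0 ≤ f t)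
    (hf : Integrable f) {S : Set ℝ} (hS : MeasurableSet S) :
    ∫⁻ t in {t | (∫ s in Set.Iic t, f s) / ∫ s, f s ∈ S}, ENNReal.ofReal (f t) =
      volume (S ∩ Set.Ioo 0 1) * ∫⁻ t, ENNReal.ofReal (f t) := by
  set c := ∫⁻ t, ENNReal.ofReal (f t) with hc
  have hcf : c = ENNReal.ofReal (∫ t, f t) :=
    (ofReal_integral_eq_lintegral_ofReal hf (Filter.Eventually.of_forall hf0)).symm
  rcases eq_or_ne c 0 with h0 | h0
  · rw [h0, mul_zero]
    exact nonpos_iff_eq_zero.1 ((setLIntegral_le_lintegral _ _).trans_eq (hc.symm.trans h0))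
  have htop : c ≠ ⊤ := by rw [hcf]; exact ENNReal.ofReal_ne_top
  set ν := (volume : Measure ℝ).withDensity fun t => ENNReal.ofReal (f t) with hν
  have hνuniv : ν Set.univ = c := by
    rw [hν, withDensity_apply _ MeasurableSet.univ, setLIntegral_univ]
  let ρ : Measure ℝ := c⁻¹ • ν
  have hρ : IsProbabilityMeasure ρ := ⟨by
    rw [Measure.smul_apply, hνuniv, smul_eq_mul, ENNReal.inv_mul_cancel h0 htop]⟩
  have hna : NullSingletonClass ρ := ⟨fun x => by
    rw [Measure.smul_apply, hν, withDensity_apply _ (measurableSet_singleton x)]; simp⟩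
  have hcdf : ∀ t, cdf ρ t = (∫ s in Set.Iic t, f s) / ∫ s, f s := by
    intro t
    rw [cdf_eq_real, Measure.real, Measure.smul_apply, hν, withDensity_apply _ measurableSet_Iic,
      ← ofReal_integral_eq_lintegral_ofReal hf.integrableOn (Filter.Eventually.of_forall hf0),
      smul_eq_mul, ENNReal.toReal_mul, ENNReal.toReal_inv, hcf,
      ENNReal.toReal_ofReal (integral_nonneg hf0), ENNReal.toReal_ofReal (integral_nonneg hf0),
      div_eq_inv_mul]
  have hm : Measurable (cdf ρ) := (monotone_cdf ρ).measurable
  have hset : {t | (∫ s in Set.Iic t, f s) / ∫ s, f s ∈ S} = cdf ρ ⁻¹' S := by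
    ext t; rw [Set.mem_preimage, hcdf]; rfl
  have hmap := congrArg (fun κ : Measure ℝ => κ S) (map_cdf ρ)
  rw [Measure.map_apply hm hS, Measure.restrict_apply hS, Measure.smul_apply, smul_eq_mul, hν,
    withDensity_apply _ (hm hS)] at hmap
  rw [hset, ← hmap, mul_comm, ← mul_assoc, ENNReal.mul_inv_cancel h0 htop, one_mul]

/-! ### One-dimensional box integrals -/

theorem gaussDensity_unique {ι : Type*} [Unique ι] [Fintype ι] [DecidableEq ι] (m : ι → ℝ)
    (C : Matrix ι ι ℝ) (u : ι → ℝ) :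
    gaussDensity m C u = gaussianPDFReal (m default) (C default default).toNNReal (u default) := by
  have hcard : Fintype.card ι = 1 := by
    rw [Fintype.card_eq_one_iff]; exact ⟨default, fun i => Subsingleton.elim _ _⟩
  have hquad : (u - m) ⬝ᵥ (C⁻¹ *ᵥ (u - m)) =
      (C default default)⁻¹ * (u default - m default) ^ 2 := by
    rw [Matrix.inv_subsingleton]
    simp only [dotProduct, Matrix.mulVec_diagonal, Pi.sub_apply]
    rw [Fintype.sum_subsingleton _ default, Ring.inverse_eq_inv']
    ring
  have hdet : C.det = C default default := by
    rw [Matrix.det_eq_elem_of_subsingleton C default]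
  rw [gaussDensity, hquad, hcard, hdet, gaussianPDFReal_def, pow_one]
  rcases le_or_gt (C default default) 0 with h | h
  · -- without a positive variance both normalizing constants are `0⁻¹ = 0`
    rw [Real.sqrt_eq_zero_of_nonpos (mul_nonpos_of_nonneg_of_nonpos (by positivity) h),
      Real.toNNReal_of_nonpos h]
    simp
  · simp only [Real.coe_toNNReal _ h.le]
    congr 2
    field_simp

theorem exists_setIntegral_box_eq {K : Type*} [Fintype K] [DecidableEq K] {I : Finset K}
    (hI : Iᶜ.card = 1) : ∃ k : ↥Iᶜ, ∀ (m : ↥Iᶜ → ℝ) (C : Matrix ↥Iᶜ ↥Iᶜ ℝ) (d : I → ℝ),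
      ∫ u in box I d, gaussDensity m C u =
        ∫ x in {x : ℝ | 0 < x ∧ (x : EReal) < minVal I d},
          gaussianPDFReal (m k) (C k k).toNNReal x := by
  obtain ⟨k, hk⟩ := Finset.card_eq_one.1 hI
  have hkmem : k ∈ Iᶜ := by rw [hk]; exact Finset.mem_singleton_self k
  let _ : Unique ↥Iᶜ := ⟨⟨⟨k, hkmem⟩⟩, fun j =>
    Subtype.ext (Finset.mem_singleton.1 (hk.subset j.2))⟩
  refine ⟨default, fun m C d => ?_⟩
  have hmp : MeasurePreserving (MeasurableEquiv.funUnique ↥Iᶜ ℝ) volume volume := by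
    convert volume_preserving_funUnique ↥Iᶜ ℝ
  rw [← hmp.setIntegral_preimage_emb (MeasurableEquiv.measurableEmbedding _)]
  have hset : box I d = MeasurableEquiv.funUnique ↥Iᶜ ℝ ⁻¹'
      {x : ℝ | 0 < x ∧ (x : EReal) < minVal I d} := by
    ext u
    exact Unique.forall_iff
  rw [hset]
  simp_rw [gaussDensity_unique]
  rfl

/-! ### The event that a given tree is grown -/

section Tree

variable {p n : ℕ}

/-- `bestSplit` is the first maximizer: it weakly beats every allowed split, and strictly those that
precede it. -/
theorem bestSplit_eq_iff {C : Finset (Split p n)} (hC : C.Nonempty) (f : Split p n → ℝ)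
    (s : Split p n) :
    bestSplit C hC f = s ↔ s ∈ C ∧ ∀ s' ∈ C, f s' ≤ f s ∧ (s' < s → f s' < f s) := by
  classical
  constructor
  · rintro rfl
    have hmem := Finset.min'_mem (C.filter fun s => ∀ s' ∈ C, f s' ≤ f s) (by
      obtain ⟨s, hs, hmax⟩ := C.exists_max_image f hC
      exact ⟨s, Finset.mem_filter.2 ⟨hs, hmax⟩⟩)
    have hmem' : bestSplit C hC f ∈ C.filter fun s => ∀ s' ∈ C, f s' ≤ f s := by
      convert hmem using 1
      unfold bestSplit
      congr
    rw [Finset.mem_filter] at hmem'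
    refine ⟨hmem'.1, fun s' hs' => ⟨hmem'.2 s' hs', fun hlt => ?_⟩⟩
    refine lt_of_le_of_ne (hmem'.2 s' hs') fun heq => absurd hlt (not_lt.2 ?_)
    unfold bestSplit
    exact Finset.min'_le _ _ (Finset.mem_filter.2 ⟨hs', fun t ht => (hmem'.2 t ht).trans heq.ge⟩)
  · rintro ⟨hs, hmax⟩
    refine le_antisymm (Finset.min'_le _ _ (Finset.mem_filter.2 ⟨hs, fun t ht => (hmax t ht).1⟩)) ?_
    refine Finset.le_min' _ _ _ fun t ht => not_lt.1 fun hlt => ?_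
    rw [Finset.mem_filter] at ht
    exact absurd ((hmax t ht.1).2 hlt) (not_lt.2 (ht.2 s hs))

variable (X : Fin n → Fin p → ℝ) (χ : Set (Fin p → ℝ) → Finset (Split p n))
  (G : (Fin n → ℝ) → Set (Fin p → ℝ) → Split p n → ℝ)

/-- A node at which the tree may be split: its region has more than one observation and some split
is allowed. -/
def IsSplittable (h : Node p n) : Prop :=
  1 < (obs X (region X h)).card ∧ (χ (region X h)).Nonempty

/-- The split `s` is the one chosen at the node `h`: it is allowed, and maximizes the randomized
gain, ties being broken by the order of the splits. -/
def IsChosen (y : Fin n → ℝ) (w : Node p n → Split p n → ℝ) (h : Node p n) (s : Split p n) :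
    Prop :=
  s ∈ χ (region X h) ∧ ∀ s' ∈ χ (region X h),
    G y (region X h) s' + w h s' ≤ G y (region X h) s + w h s ∧
      (s' < s → G y (region X h) s' + w h s' < G y (region X h) s + w h s)

variable {X χ G}

theorem grow_eq_leaf_iff {y : Fin n → ℝ} {w : Node p n → Split p n → ℝ} {k : ℕ} {h : Node p n} :
    grow X χ G y w k h = .leaf ↔ k = 0 ∨ ¬ IsSplittable X χ h := by
  cases k with
  | zero => simp [grow]
  | succ k =>
    by_cases hc : IsSplittable X χ h
    · have hc' : 1 < (obs X (region X h)).card ∧ (χ (region X h)).Nonempty := hc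
      rw [grow, dif_pos hc']; simp [hc]
    · have hc' : ¬ (1 < (obs X (region X h)).card ∧ (χ (region X h)).Nonempty) := hc
      rw [grow, dif_neg hc']; simp [hc]

theorem grow_succ_eq_node_iff {y : Fin n → ℝ} {w : Node p n → Split p n → ℝ} {k : ℕ}
    {h : Node p n} {s : Split p n} {l r : SplitTree p n} :
    grow X χ G y w (k + 1) h = .node s l r ↔
      IsSplittable X χ h ∧ IsChosen X χ G y w h s ∧
        grow X χ G y w k (h ++ [(s, true)]) = l ∧ grow X χ G y w k (h ++ [(s, false)]) = r := by
  by_cases hc : IsSplittable X χ h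
  · have hc' : 1 < (obs X (region X h)).card ∧ (χ (region X h)).Nonempty := hc
    rw [grow, dif_pos hc', SplitTree.node.injEq]
    have hs := bestSplit_eq_iff hc.2 (fun s => G y (region X h) s + w h s) s
    constructor
    · rintro ⟨h1, h2, h3⟩
      rw [h1] at h2 h3
      exact ⟨hc, hs.1 h1, h2, h3⟩
    · rintro ⟨-, h1, h2, h3⟩
      rw [hs.2 h1]
      exact ⟨rfl, h2, h3⟩
  · have hc' : ¬ (1 < (obs X (region X h)).card ∧ (χ (region X h)).Nonempty) := hc
    rw [grow, dif_neg hc']; simp [hc]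

theorem region_append (h : Node p n) (s : Split p n) (b : Bool) :
    region X (h ++ [(s, b)]) = child X (region X h) s b := by
  simp [region]

theorem child_subset (P : Set (Fin p → ℝ)) (s : Split p n) (b : Bool) : child X P s b ⊆ P := by
  cases b <;> exact fun z hz => hz.1

theorem disjoint_child (P : Set (Fin p → ℝ)) (s : Split p n) (b : Bool) :
    Disjoint (child X P s b) (child X P s !b) := by
  rw [Set.disjoint_left]
  cases b
  · exact fun z hz hz' => absurd hz.2 (not_lt.2 hz'.2)
  · exact fun z hz hz' => absurd hz'.2 (not_lt.2 hz.2)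

theorem region_append_subset (h g : Node p n) : region X (h ++ g) ⊆ region X h := by
  induction g using List.reverseRecOn with
  | nil => simp
  | append_singleton g e ih =>
    rw [← List.append_assoc]
    exact (region_append (X := X) (h ++ g) e.1 e.2 ▸ child_subset _ _ _).trans ih

/-- The subtree grown from `h` depends on the responses in the region of `h` and on the
randomizations at the descendants of `h`. -/
theorem grow_congr (hG : IsGain X G) {y y' : Fin n → ℝ} {w w' : Node p n → Split p n → ℝ} (k : ℕ)
    (h : Node p n) (hy : ∀ i, X i ∈ region X h → y i = y' i)
    (hw : ∀ g, h <+: g → w g = w' g) : grow X χ G y w k h = grow X χ G y' w' k h := by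
  induction k generalizing h with
  | zero => rfl
  | succ k ih =>
    have hgain : (fun s => G y (region X h) s + w h s) = fun s => G y' (region X h) s + w' h s := by
      funext s
      rw [(hG _ s).2 y y' hy, hw h (List.prefix_refl h)]
    by_cases hc : 1 < (obs X (region X h)).card ∧ (χ (region X h)).Nonempty
    · have hsub : ∀ e : Split p n × Bool, grow X χ G y w k (h ++ [e]) =
          grow X χ G y' w' k (h ++ [e]) := fun e =>
        ih (h ++ [e]) (fun i hi => hy i (region_append_subset h [e] hi))
          fun g hg => hw g ((List.prefix_append h [e]).trans hg)
      rw [grow, dif_pos hc, grow, dif_pos hc]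
      simp only [hgain, hsub]
    · rw [grow, dif_neg hc, grow, dif_neg hc]

variable (X χ G)

/-- The part of the event `grow y w k h = T` that does not concern the splits made along the path
`g` from `h` to a terminal node of `T`: the nodes of the path are splittable, its end is not, and
the subtrees hanging off the path are those of `T`. -/
def OffPath (y : Fin n → ℝ) (w : Node p n → Split p n → ℝ) :
    ℕ → Node p n → SplitTree p n → Node p n → Prop
  | k, h, T, [] => T = .leaf ∧ (k = 0 ∨ ¬ IsSplittable X χ h)
  | k + 1, h, .node s l r, (s', true) :: g => IsSplittable X χ h ∧ s = s' ∧
      OffPath y w k (h ++ [(s, true)]) l g ∧ grow X χ G y w k (h ++ [(s, false)]) = r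
  | k + 1, h, .node s l r, (s', false) :: g => IsSplittable X χ h ∧ s = s' ∧
      OffPath y w k (h ++ [(s, false)]) r g ∧ grow X χ G y w k (h ++ [(s, true)]) = l
  | _, _, _, _ :: _ => False

variable {X χ G}

/-- The tree `T` is grown iff the splits on the path to one of its terminal nodes are chosen and
everything off this path agrees with `T`. -/
theorem grow_eq_iff {y : Fin n → ℝ} {w : Node p n → Split p n → ℝ} (k : ℕ) (h : Node p n)
    (T : SplitTree p n) (g : Node p n) (hg : g ∈ T.leaves) :
    grow X χ G y w k h = T ↔ OffPath X χ G y w k h T g ∧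
      ∀ l : Fin g.length, IsChosen X χ G y w (h ++ g.take l) (g.get l).1 := by
  induction T generalizing k h g with
  | leaf =>
    obtain rfl : g = [] := by simpa [SplitTree.leaves] using hg
    simp [OffPath, grow_eq_leaf_iff]
  | node s l r ihl ihr =>
    have key : ∀ (b : Bool) (g' : Node p n),
        (∀ i : Fin ((s, b) :: g').length,
          IsChosen X χ G y w (h ++ ((s, b) :: g').take i) (((s, b) :: g').get i).1) ↔
        IsChosen X χ G y w h s ∧ ∀ i : Fin g'.length,
          IsChosen X χ G y w ((h ++ [(s, b)]) ++ g'.take i) (g'.get i).1 := by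
      intro b g'
      refine Fin.forall_fin_succ.trans ?_
      simp
    rw [SplitTree.leaves, List.mem_append, List.mem_map, List.mem_map] at hg
    rcases hg with ⟨g', hg', rfl⟩ | ⟨g', hg', rfl⟩
    · rw [key]
      cases k with
      | zero => simp [OffPath, grow]
      | succ k =>
        rw [grow_succ_eq_node_iff, OffPath, ihl k _ g' hg']
        tauto
    · rw [key]
      cases k with
      | zero => simp [OffPath, grow]
      | succ k =>
        rw [grow_succ_eq_node_iff, OffPath, ihr k _ g' hg']
        tauto

theorem not_prefix_of_sibling_prefix {h g h' : Node p n} {s : Split p n} {b : Bool}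
    (hh : h ++ [(s, !b)] <+: h') : ¬ h' <+: h ++ (s, b) :: g := by
  intro hpre
  have := hh.trans hpre
  rw [List.prefix_append_right_inj, List.cons_prefix_cons] at this
  have h2 := congrArg Prod.snd this.1
  cases b <;> simp at h2

/-- Off the path to a terminal node, the tree depends only on the responses outside the terminal
region and on the randomizations outside the path. -/
theorem offPath_congr (hG : IsGain X G) {y y' : Fin n → ℝ} {w w' : Node p n → Split p n → ℝ}
    (k : ℕ) (h : Node p n) (T : SplitTree p n) (g : Node p n)
    (hy : ∀ i, X i ∉ region X (h ++ g) → y i = y' i)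
    (hw : ∀ h', ¬ h' <+: h ++ g → w h' = w' h') :
    OffPath X χ G y w k h T g ↔ OffPath X χ G y' w' k h T g := by
  induction g generalizing k h T with
  | nil => simp [OffPath]
  | cons e g ih =>
    obtain ⟨s', b⟩ := e
    have hsib : ∀ (s : Split p n) (k : ℕ), s = s' →
        grow X χ G y w k (h ++ [(s, !b)]) = grow X χ G y' w' k (h ++ [(s, !b)]) := by
      rintro s k rfl
      refine grow_congr hG k _ (fun i hi => hy i fun hi' => ?_) fun h' hh' => hw h' ?_
      · have h1 : X i ∈ region X (h ++ [(s, b)]) := by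
          rw [List.append_cons] at hi'
          exact region_append_subset _ _ hi'
        rw [region_append] at hi h1
        exact Set.disjoint_left.1 (disjoint_child (X := X) (region X h) s b) h1 hi
      · exact not_prefix_of_sibling_prefix hh'
    have hih : ∀ (s : Split p n) (k : ℕ) (T : SplitTree p n), s = s' →
        (OffPath X χ G y w k (h ++ [(s, b)]) T g ↔ OffPath X χ G y' w' k (h ++ [(s, b)]) T g) := by
      rintro s k T rfl
      refine ih k (h ++ [(s, b)]) T (fun i hi => hy i ?_) fun h' hh' => hw h' ?_
      · rwa [List.append_cons]
      · rwa [List.append_cons]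
    cases k with
    | zero => simp [OffPath]
    | succ k =>
      cases T with
      | leaf => simp [OffPath]
      | node s l r =>
        cases b with
        | true =>
          simp only [OffPath]
          refine and_congr_right fun _ => and_congr_right fun hs => ?_
          have hs' : grow X χ G y w k (h ++ [(s, false)]) = _ := hsib s k hs
          rw [hih s k l hs, hs']; rfl
        | false =>
          simp only [OffPath]
          refine and_congr_right fun _ => and_congr_right fun hs => ?_
          have hs' : grow X χ G y w k (h ++ [(s, true)]) = _ := hsib s k hs
          rw [hih s k r hs, hs']; rfl

theorem measurableSet_isChosen (hG : IsGain X G) (h : Node p n) (s : Split p n) :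
    MeasurableSet {q : (Fin n → ℝ) × (Node p n → Split p n → ℝ) |
      IsChosen X χ G q.1 q.2 h s} := by
  have hm : ∀ s, Measurable fun q : (Fin n → ℝ) × (Node p n → Split p n → ℝ) =>
      G q.1 (region X h) s + q.2 h s := fun s =>
    ((hG (region X h) s).1.comp measurable_fst).add
      ((measurable_pi_apply s).comp ((measurable_pi_apply h).comp measurable_snd))
  unfold IsChosen
  rw [Set.ofPred_and, Set.ofPred_forall]
  refine (MeasurableSet.const _).inter (MeasurableSet.iInter fun s' => ?_)
  by_cases hs' : s' ∈ χ (region X h)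
  · simp only [hs', forall_const]
    refine (measurableSet_le (hm s') (hm s)).inter ?_
    by_cases hlt : s' < s
    · simp only [hlt, forall_const]
      exact measurableSet_lt (hm s') (hm s)
    · simp only [hlt, false_imp_iff]
      exact MeasurableSet.const _
  · simp [hs']

theorem measurableSet_grow_eq (hG : IsGain X G) (k : ℕ) (h : Node p n) (T : SplitTree p n) :
    MeasurableSet {q : (Fin n → ℝ) × (Node p n → Split p n → ℝ) |
      grow X χ G q.1 q.2 k h = T} := by
  induction k generalizing h T with
  | zero => simp only [grow]; exact MeasurableSet.const _
  | succ k ih =>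
    cases T with
    | leaf => simp only [grow_eq_leaf_iff]; exact MeasurableSet.const _
    | node s l r =>
      simp only [grow_succ_eq_node_iff]
      exact (MeasurableSet.const _).inter ((measurableSet_isChosen hG h s).inter
        ((ih _ l).inter (ih _ r)))

theorem measurableSet_offPath (hG : IsGain X G) (k : ℕ) (h : Node p n) (T : SplitTree p n)
    (g : Node p n) :
    MeasurableSet {q : (Fin n → ℝ) × (Node p n → Split p n → ℝ) |
      OffPath X χ G q.1 q.2 k h T g} := by
  induction g generalizing k h T with
  | nil => simp only [OffPath]; exact MeasurableSet.const _
  | cons e g ih =>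
    obtain ⟨s', b⟩ := e
    cases k with
    | zero => simp [OffPath]
    | succ k =>
      cases T with
      | leaf => simp [OffPath]
      | node s l r =>
        cases b with
        | true =>
          simp only [OffPath]
          exact (MeasurableSet.const _).inter ((MeasurableSet.const _).inter
            ((ih _ _ _).inter (measurableSet_grow_eq hG _ _ _)))
        | false =>
          simp only [OffPath]
          exact (MeasurableSet.const _).inter ((MeasurableSet.const _).inter
            ((ih _ _ _).inter (measurableSet_grow_eq hG _ _ _)))

/-- In the absence of ties, the splits on the path to `h` are chosen iff all differences of
randomized gains are positive. -/
theorem forall_isChosen_iff {y : Fin n → ℝ} {w : Node p n → Split p n → ℝ} {h : Node p n}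
    (hmem : ∀ l : Fin h.length, ancSplit h l ∈ χ (parent X h l))
    (hne : ∀ l k, randGainDiff X χ G h y w l k ≠ 0) :
    (∀ l : Fin h.length, IsChosen X χ G y w (h.take l) (h.get l).1) ↔
      ∀ l k, 0 < randGainDiff X χ G h y w l k := by
  refine forall_congr' fun l => ?_
  constructor
  · rintro ⟨-, hc⟩ k
    have hk := (hc k (Finset.mem_of_mem_erase k.2)).1
    refine lt_of_le_of_ne ?_ (hne l k).symm
    simp only [randGainDiff, parent, ancSplit]
    linarith
  · intro hpos
    refine ⟨hmem l, fun s' hs' => ?_⟩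
    by_cases hs : s' = ancSplit h l
    · subst hs
      exact ⟨le_rfl, fun hlt => absurd hlt (lt_irrefl _)⟩
    · have hD := hpos ⟨s', Finset.mem_erase.2 ⟨hs, hs'⟩⟩
      simp only [randGainDiff, parent, ancSplit] at hD
      have hlt : G y (region X (h.take l)) s' + w (h.take l) s' <
          G y (region X (h.take l)) (h.get l).1 + w (h.take l) (h.get l).1 := by linarith
      exact ⟨hlt.le, fun _ => hlt⟩

end Tree

/-! ### Uniformity of the pivot for several independent selections -/

section Pivot

variable {ι : Type*} [Fintype ι] {K : ι → Type*} [∀ l, Fintype (K l)] [∀ l, DecidableEq (K l)]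

/-- The correction as a function of the differences of gains `β` and of the codes `a` of the
conditioned data. -/
def corrCode (τ : ι → ℝ≥0) (β : ∀ l, K l → ℝ) (a : ∀ l, K l → Prop × ℝ) : ℝ :=
  ∏ l, gammaCode (diffCov (K l) (τ l)) (β l) (a l)

/-- The joint law of the differences of randomizations at all selections. -/
def noiseLaw (K : ι → Type*) [∀ l, Fintype (K l)] [∀ l, DecidableEq (K l)] (τ : ι → ℝ≥0) :
    Measure (∀ l, K l → ℝ) :=
  Measure.pi fun l =>
    volume.withDensity fun e => ENNReal.ofReal (gaussDensity 0 (diffCov (K l) (τ l)) e)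

/-- The pivot as a function of the codes `a` of the conditioned data, of the linear statistic `t`
and of a nuisance statistic `q`, on which the differences of gains `β` depend. -/
def pivotCode {𝒬 : Type*} (τ : ι → ℝ≥0) (β : ℝ → 𝒬 → ∀ l, K l → ℝ) (θ : ℝ) (v : ℝ≥0)
    (a : ∀ l, K l → Prop × ℝ) (t : ℝ) (q : 𝒬) : ℝ :=
  (∫ s in Set.Iic t, gaussianPDFReal θ v s * corrCode τ (β s q) a) /
    ∫ s, gaussianPDFReal θ v s * corrCode τ (β s q) a

theorem map_add_withDensity_gaussDensity {κ : Type*} [Fintype κ] [DecidableEq κ]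
    (m : κ → ℝ) (C : Matrix κ κ ℝ) :
    (volume.withDensity fun e => ENNReal.ofReal (gaussDensity 0 C e)).map (fun e => m + e) =
      volume.withDensity fun e => ENNReal.ofReal (gaussDensity m C e) := by
  have hm : Measurable fun e : κ → ℝ => m + e := by fun_prop
  ext S hS
  rw [Measure.map_apply hm hS, withDensity_apply _ (hm hS), withDensity_apply _ hS,
    ← lintegral_indicator (hm hS), ← lintegral_indicator hS,
    ← lintegral_add_left_eq_self (S.indicator _) m]
  refine lintegral_congr fun e => ?_
  rw [← Set.indicator_comp_right (fun e => m + e)]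
  simp only [Set.indicator, Function.comp_apply]
  rw [gaussDensity_eq_sub m, add_sub_cancel_left]

theorem isProbabilityMeasure_withDensity_diffCov {κ : Type*} [Fintype κ] [DecidableEq κ]
    {τ : ℝ≥0} (hτ : 0 < τ) (m : κ → ℝ) : IsProbabilityMeasure
      (volume.withDensity fun e => ENNReal.ofReal (gaussDensity m (diffCov κ τ) e)) :=
  ⟨by rw [withDensity_apply _ MeasurableSet.univ, setLIntegral_univ,
    lintegral_gaussDensity_diffCov hτ]⟩

theorem isProbabilityMeasure_noiseLaw {τ : ι → ℝ≥0} (hτ : ∀ l, 0 < τ l) :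
    IsProbabilityMeasure (noiseLaw K τ) := by
  have := fun l => isProbabilityMeasure_withDensity_diffCov (κ := K l) (hτ l) 0
  unfold noiseLaw
  infer_instance

theorem corrCode_nonneg {τ : ι → ℝ≥0} (hτ : ∀ l, 0 < τ l) (β : ∀ l, K l → ℝ)
    (a : ∀ l, K l → Prop × ℝ) : 0 ≤ corrCode τ β a :=
  Finset.prod_nonneg fun l _ => gammaCode_nonneg (hτ l) _ _

theorem exists_corrCode_le {τ : ι → ℝ≥0} (hτ : ∀ l, 0 < τ l) (a : ∀ l, K l → Prop × ℝ) :
    ∃ C : ℝ, ∀ β : ∀ l, K l → ℝ, corrCode τ β a ≤ C := by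
  choose C hC using fun l => exists_gammaFactor_le (hτ l) (codeIdx (a l)) fun k => (a l k).2
  exact ⟨∏ l, C l, fun β => Finset.prod_le_prod (fun l _ => gammaCode_nonneg (hτ l) _ _)
    fun l _ => hC l (β l)⟩

theorem measurable_corrCode (τ : ι → ℝ≥0) :
    Measurable fun x : (∀ l, K l → ℝ) × (∀ l, K l → Prop × ℝ) => corrCode τ x.1 x.2 := by
  refine Finset.measurable_prod _ fun l _ => ?_
  have hm : Measurable fun x : (∀ l, K l → ℝ) × (∀ l, K l → Prop × ℝ) => (x.1 l, x.2 l) :=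
    ((measurable_pi_apply l).comp measurable_fst).prodMk
      ((measurable_pi_apply l).comp measurable_snd)
  have hc := (measurable_gammaCode (diffCov (K l) (τ l))).comp hm
  exact hc

variable {𝒬 : Type*} [MeasurableSpace 𝒬]

theorem measurable_pivotIntegrand (τ : ι → ℝ≥0) {β : ℝ → 𝒬 → ∀ l, K l → ℝ}
    (hβ : Measurable fun x : ℝ × 𝒬 => β x.1 x.2) (θ : ℝ) (v : ℝ≥0) :
    Measurable fun x : ((∀ l, K l → Prop × ℝ) × 𝒬) × ℝ =>
      gaussianPDFReal θ v x.2 * corrCode τ (β x.2 x.1.2) x.1.1 := by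
  have h0 : Measurable fun x : ((∀ l, K l → Prop × ℝ) × 𝒬) × ℝ => x.2 := measurable_snd
  refine ((measurable_gaussianPDFReal θ v).comp h0).mul ?_
  have h1 : Measurable fun x : ((∀ l, K l → Prop × ℝ) × 𝒬) × ℝ => β x.2 x.1.2 :=
    hβ.comp (measurable_snd.prodMk (measurable_snd.comp measurable_fst))
  have hc := (measurable_corrCode τ).comp (h1.prodMk (measurable_fst.comp measurable_fst))
  exact hc

theorem measurable_pivotCode (τ : ι → ℝ≥0) {β : ℝ → 𝒬 → ∀ l, K l → ℝ}
    (hβ : Measurable fun x : ℝ × 𝒬 => β x.1 x.2) (θ : ℝ) (v : ℝ≥0) :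
    Measurable fun x : (∀ l, K l → Prop × ℝ) × ℝ × 𝒬 => pivotCode τ β θ v x.1 x.2.1 x.2.2 := by
  have hg : Measurable fun p : ((∀ l, K l → Prop × ℝ) × ℝ × 𝒬) × ℝ =>
      gaussianPDFReal θ v p.2 * corrCode τ (β p.2 p.1.2.2) p.1.1 := by
    have hm : Measurable fun p : ((∀ l, K l → Prop × ℝ) × ℝ × 𝒬) × ℝ => ((p.1.1, p.1.2.2), p.2) :=
      ((measurable_fst.comp measurable_fst).prodMk
        (measurable_snd.comp (measurable_snd.comp measurable_fst))).prodMk measurable_snd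
    have hf := (measurable_pivotIntegrand τ hβ θ v).comp hm
    exact hf
  refine Measurable.div ?_ ?_
  · have hind : ∀ x : (∀ l, K l → Prop × ℝ) × ℝ × 𝒬,
        ∫ s in Set.Iic x.2.1, gaussianPDFReal θ v s * corrCode τ (β s x.2.2) x.1 =
        ∫ s, {p : ((∀ l, K l → Prop × ℝ) × ℝ × 𝒬) × ℝ | p.2 ≤ p.1.2.1}.indicator
          (fun p => gaussianPDFReal θ v p.2 * corrCode τ (β p.2 p.1.2.2) p.1.1) (x, s) := by
      intro x
      rw [← integral_indicator measurableSet_Iic]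
      rfl
    simp_rw [hind]
    have hset : MeasurableSet {p : ((∀ l, K l → Prop × ℝ) × ℝ × 𝒬) × ℝ | p.2 ≤ p.1.2.1} :=
      measurableSet_le measurable_snd
        (measurable_fst.comp (measurable_snd.comp measurable_fst))
    exact (hg.indicator hset).stronglyMeasurable.integral_prod_right'.measurable
  · exact hg.stronglyMeasurable.integral_prod_right'.measurable

theorem integrable_pivotIntegrand {τ : ι → ℝ≥0} (hτ : ∀ l, 0 < τ l) {β : ℝ → 𝒬 → ∀ l, K l → ℝ}
    (hβ : Measurable fun x : ℝ × 𝒬 => β x.1 x.2) (θ : ℝ) (v : ℝ≥0)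
    (a : ∀ l, K l → Prop × ℝ) (q : 𝒬) :
    Integrable fun s => gaussianPDFReal θ v s * corrCode τ (β s q) a := by
  obtain ⟨C, hC⟩ := exists_corrCode_le hτ a
  refine ((integrable_gaussianPDFReal θ v).mul_const C).mono'
    ((measurable_pivotIntegrand τ hβ θ v).comp
      (measurable_prodMk_left (x := (a, q)))).aestronglyMeasurable
    (Filter.Eventually.of_forall fun s => ?_)
  rw [Real.norm_of_nonneg (mul_nonneg (gaussianPDFReal_nonneg _ _ _) (corrCode_nonneg hτ _ _))]
  exact mul_le_mul_of_nonneg_left (hC _) (gaussianPDFReal_nonneg _ _ _)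

end Pivot

section Selection

variable {ι : Type*} [Fintype ι] {K : ι → Type*} [∀ l, Fintype (K l)] [∀ l, LinearOrder (K l)]
  [∀ l, DecidableEq (K l)] {𝒬 : Type*} [MeasurableSpace 𝒬]

theorem measurableSet_pos (κ : Type*) [Finite κ] : MeasurableSet {D : κ → ℝ | ∀ k, 0 < D k} := by
  rw [Set.ofPred_forall]
  exact MeasurableSet.iInter fun k => measurableSet_lt measurable_const (measurable_pi_apply k)

/-- On the event that one vector of differences is positive, the conditioned data have the factor of
the correction as their density. -/
theorem map_topCode_restrict_pos {κ : Type*} [Fintype κ] [LinearOrder κ] [DecidableEq κ]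
    {τ : ℝ≥0} (hτ : 0 < τ) {r : ℕ} (hr : r ≤ Fintype.card κ) (m : κ → ℝ) :
    ((volume.withDensity fun e => ENNReal.ofReal (gaussDensity m (diffCov κ τ) e)).restrict
        {D | ∀ k, 0 < D k}).map (topCode r) =
      (codeMeasure κ r).withDensity fun a => ENNReal.ofReal (gammaCode (diffCov κ τ) m a) := by
  ext S hS
  have hpre : MeasurableSet (topCode r ⁻¹' S : Set (κ → ℝ)) := measurable_topCode r hS
  rw [Measure.map_apply (measurable_topCode r) hS, Measure.restrict_apply hpre,
    withDensity_apply _ (hpre.inter (measurableSet_pos κ)), withDensity_apply _ hS]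
  have h := lintegral_pos_gaussDensity hτ hr m (H := S.indicator 1)
    (measurable_one.indicator hS)
  have hl : ∀ D : κ → ℝ, S.indicator 1 (topCode r D) *
      ENNReal.ofReal (gaussDensity m (diffCov κ τ) D) = (topCode r ⁻¹' S).indicator
        (fun D => ENNReal.ofReal (gaussDensity m (diffCov κ τ) D)) D := fun D => by
    by_cases hD : topCode r D ∈ S <;> simp [hD]
  have hR : ∀ a : κ → Prop × ℝ, S.indicator 1 a * ENNReal.ofReal (gammaCode (diffCov κ τ) m a) =
      S.indicator (fun a => ENNReal.ofReal (gammaCode (diffCov κ τ) m a)) a := fun a => by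
    by_cases ha : a ∈ S <;> simp [ha]
  simp_rw [hl, hR] at h
  rwa [lintegral_indicator hpre, Measure.restrict_restrict hpre, lintegral_indicator hS] at h

/-- On the event that all differences of randomized gains are positive, the joint law of the
conditioned data has the correction as its density. -/
theorem setLIntegral_noiseLaw {τ : ι → ℝ≥0} (hτ : ∀ l, 0 < τ l) {r : ℕ}
    (hr : ∀ l, r ≤ Fintype.card (K l)) (β : ∀ l, K l → ℝ)
    {H : (∀ l, K l → Prop × ℝ) → ENNReal} (hH : Measurable H) :
    ∫⁻ e in {e | ∀ l k, 0 < β l k + e l k}, H (fun l => topCode r (β l + e l)) ∂noiseLaw K τ =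
      ∫⁻ a, H a * ENNReal.ofReal (corrCode τ β a) ∂Measure.pi fun l => codeMeasure (K l) r := by
  have hprob := fun l => isProbabilityMeasure_withDensity_diffCov (κ := K l) (hτ l) 0
  have hprob' := fun l => isProbabilityMeasure_withDensity_diffCov (κ := K l) (hτ l) (β l)
  have hpi : (noiseLaw K τ).map (fun e l => β l + e l) = Measure.pi fun l =>
      volume.withDensity fun e => ENNReal.ofReal (gaussDensity (β l) (diffCov (K l) (τ l)) e) := by
    simp_rw [← map_add_withDensity_gaussDensity (β _)]
    have hσ : ∀ l, SigmaFinite ((volume.withDensity fun e => ENNReal.ofReal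
        (gaussDensity 0 (diffCov (K l) (τ l)) e)).map fun e => β l + e) := fun l => by
      rw [map_add_withDensity_gaussDensity]; infer_instance
    exact Measure.pi_map_pi fun l => (by fun_prop : Measurable fun e : K l → ℝ =>
      β l + e).aemeasurable
  have hset : {e : ∀ l, K l → ℝ | ∀ l k, 0 < β l k + e l k} = (fun e l => β l + e l) ⁻¹'
      (Set.univ.pi fun l => {D : K l → ℝ | ∀ k, 0 < D k}) := by
    ext e; simp
  have hm : Measurable fun (e : ∀ l, K l → ℝ) l => β l + e l := by fun_prop
  have htop : Measurable fun (D : ∀ l, K l → ℝ) l => topCode r (D l) :=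
    measurable_pi_lambda _ fun l => (measurable_topCode r).comp (measurable_pi_apply l)
  have hσ' : ∀ l, SigmaFinite ((codeMeasure (K l) r).withDensity fun a =>
      ENNReal.ofReal (gammaCode (diffCov (K l) (τ l)) (β l) a)) := fun l => by
    rw [← map_topCode_restrict_pos (hτ l) (hr l)]; infer_instance
  have hσ'' : ∀ l, SigmaFinite (((volume.withDensity fun e => ENNReal.ofReal
      (gaussDensity (β l) (diffCov (K l) (τ l)) e)).restrict {D | ∀ k, 0 < D k}).map
        (topCode r)) := fun l => inferInstance
  have hγ : ∀ l, Measurable fun a => ENNReal.ofReal (gammaCode (diffCov (K l) (τ l)) (β l) a) :=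
    fun l => ((measurable_gammaCode _).comp measurable_prodMk_left).ennreal_ofReal
  have h0 := setLIntegral_map (μ := noiseLaw K τ)
    (MeasurableSet.univ_pi fun l => measurableSet_pos (K l)) (hH.comp htop) hm
  simp only [Function.comp_apply] at h0
  rw [hset, ← h0, hpi, Measure.restrict_pi_pi]
  have h1 := lintegral_map (μ := Measure.pi fun l => (volume.withDensity fun e =>
    ENNReal.ofReal (gaussDensity (β l) (diffCov (K l) (τ l)) e)).restrict {D | ∀ k, 0 < D k})
    hH htop
  rw [← h1, Measure.pi_map_pi fun l => (measurable_topCode r).aemeasurable]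
  simp_rw [fun l => map_topCode_restrict_pos (hτ l) (hr l) (β l)]
  have hprod : Measurable fun a : ∀ l, K l → Prop × ℝ =>
      ∏ l, ENNReal.ofReal (gammaCode (diffCov (K l) (τ l)) (β l) (a l)) :=
    Finset.measurable_prod _ fun l _ => (hγ l).comp (measurable_pi_apply l)
  rw [pi_withDensity _ hγ, lintegral_withDensity_eq_lintegral_mul _ hprod hH]
  refine lintegral_congr fun a => ?_
  rw [Pi.mul_apply, mul_comm, corrCode,
    ENNReal.ofReal_prod_of_nonneg fun l _ => gammaCode_nonneg (hτ l) _ _]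

variable {β : ℝ → 𝒬 → ∀ l, K l → ℝ}

/-- The event of selection, that all differences of randomized gains are positive.  The three
coordinates are the nuisance statistic, the linear statistic and the differences of
randomizations. -/
def posEvent (β : ℝ → 𝒬 → ∀ l, K l → ℝ) : Set (𝒬 × ℝ × ∀ l, K l → ℝ) :=
  {x | ∀ l k, 0 < β x.2.1 x.1 l k + x.2.2 l k}

/-- The codes of the conditioned data at all selections. -/
def dataCode (β : ℝ → 𝒬 → ∀ l, K l → ℝ) (r : ℕ) (x : 𝒬 × ℝ × ∀ l, K l → ℝ) :
    ∀ l, K l → Prop × ℝ :=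
  fun l => topCode r (β x.2.1 x.1 l + x.2.2 l)

theorem measurable_randDiff {ι : Type*} {K : ι → Type*} {β : ℝ → 𝒬 → ∀ l, K l → ℝ}
    (hβ : Measurable fun x : ℝ × 𝒬 => β x.1 x.2) (l : ι) :
    Measurable fun x : 𝒬 × ℝ × ∀ l, K l → ℝ => β x.2.1 x.1 l + x.2.2 l := by
  have h1 : Measurable fun x : 𝒬 × ℝ × ∀ l, K l → ℝ => β x.2.1 x.1 :=
    hβ.comp ((measurable_fst.comp measurable_snd).prodMk measurable_fst)
  have h2 : Measurable fun x : 𝒬 × ℝ × ∀ l, K l → ℝ => x.2.2 :=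
    measurable_snd.comp measurable_snd
  exact ((measurable_pi_apply l).comp h1).add ((measurable_pi_apply l).comp h2)

theorem measurableSet_posEvent {ι : Type*} [Fintype ι] {K : ι → Type*} [∀ l, Fintype (K l)]
    {β : ℝ → 𝒬 → ∀ l, K l → ℝ} (hβ : Measurable fun x : ℝ × 𝒬 => β x.1 x.2) :
    MeasurableSet (posEvent β) := by
  unfold posEvent
  rw [Set.ofPred_forall]
  exact MeasurableSet.iInter fun l => measurable_randDiff hβ l (measurableSet_pos (K l))

theorem measurable_dataCode {ι : Type*} {K : ι → Type*} [∀ l, Fintype (K l)]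
    [∀ l, LinearOrder (K l)] {β : ℝ → 𝒬 → ∀ l, K l → ℝ}
    (hβ : Measurable fun x : ℝ × 𝒬 => β x.1 x.2)
    (r : ℕ) : Measurable (dataCode β r) :=
  measurable_pi_lambda _ fun l => (measurable_topCode r).comp (measurable_randDiff hβ l)

theorem measurable_pivotCode_dataCode (τ : ι → ℝ≥0)
    (hβ : Measurable fun x : ℝ × 𝒬 => β x.1 x.2) (θ : ℝ) (v : ℝ≥0) (r : ℕ) :
    Measurable fun x => pivotCode τ β θ v (dataCode β r x) x.2.1 x.1 := by
  have hm : Measurable fun x : 𝒬 × ℝ × ∀ l, K l → ℝ => (dataCode β r x, x.2.1, x.1) :=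
    (measurable_dataCode hβ r).prodMk
      ((measurable_fst.comp measurable_snd).prodMk measurable_fst)
  have hc := (measurable_pivotCode τ hβ θ v).comp hm
  exact hc

/-- For a fixed nuisance statistic: after the noise is integrated out, the linear statistic has an
unnormalized density whose probability integral transform is the pivot. -/
theorem lintegral_noiseLaw_pivot {τ : ι → ℝ≥0} (hτ : ∀ l, 0 < τ l) {r : ℕ}
    (hr : ∀ l, r ≤ Fintype.card (K l)) (hβ : Measurable fun x : ℝ × 𝒬 => β x.1 x.2) (θ : ℝ)
    {v : ℝ≥0} (hv : v ≠ 0) (q : 𝒬) {S : Set ℝ} (hS : MeasurableSet S)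
    {C : Set (∀ l, K l → Prop × ℝ)} (hC : MeasurableSet C) :
    ∫⁻ t, noiseLaw K τ {e | (∀ l k, 0 < β t q l k + e l k) ∧
        pivotCode τ β θ v (fun l => topCode r (β t q l + e l)) t q ∈ S ∧
        (fun l => topCode r (β t q l + e l)) ∈ C} ∂gaussianReal θ v =
      volume (S ∩ Set.Ioo 0 1) * ∫⁻ a in C, (∫⁻ t, ENNReal.ofReal
        (gaussianPDFReal θ v t * corrCode τ (β t q) a))
          ∂Measure.pi fun l => codeMeasure (K l) r := by
  set Λ := Measure.pi fun l => codeMeasure (K l) r with hΛ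
  have hpiv : Measurable fun x : (∀ l, K l → Prop × ℝ) × ℝ => pivotCode τ β θ v x.1 x.2 q := by
    have hm : Measurable fun x : (∀ l, K l → Prop × ℝ) × ℝ => (x.1, x.2, q) :=
      measurable_fst.prodMk (measurable_snd.prodMk measurable_const)
    have hc := (measurable_pivotCode τ hβ θ v).comp hm
    exact hc
  have hfm : Measurable fun x : (∀ l, K l → Prop × ℝ) × ℝ => ENNReal.ofReal
      (gaussianPDFReal θ v x.2 * corrCode τ (β x.2 q) x.1) := by
    have hm : Measurable fun x : (∀ l, K l → Prop × ℝ) × ℝ => ((x.1, q), x.2) :=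
      (measurable_fst.prodMk measurable_const).prodMk measurable_snd
    have hc := ((measurable_pivotIntegrand τ hβ θ v).comp hm).ennreal_ofReal
    exact hc
  set A : Set ((∀ l, K l → Prop × ℝ) × ℝ) :=
    {x | pivotCode τ β θ v x.1 x.2 q ∈ S ∧ x.1 ∈ C} with hA
  have hAm : MeasurableSet A := (hpiv hS).inter (measurable_fst hC)
  have hnoise : ∀ t, noiseLaw K τ {e | (∀ l k, 0 < β t q l k + e l k) ∧
        pivotCode τ β θ v (fun l => topCode r (β t q l + e l)) t q ∈ S ∧
        (fun l => topCode r (β t q l + e l)) ∈ C} =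
      ∫⁻ a, A.indicator 1 (a, t) * ENNReal.ofReal (corrCode τ (β t q) a) ∂Λ := by
    intro t
    have hm : Measurable fun e : ∀ l, K l → ℝ => fun l => topCode r (β t q l + e l) :=
      measurable_pi_lambda _ fun l => (measurable_topCode r).comp
        (measurable_const.add (measurable_pi_apply l))
    have hH : Measurable fun a : ∀ l, K l → Prop × ℝ =>
        A.indicator (1 : (∀ l, K l → Prop × ℝ) × ℝ → ENNReal) (a, t) :=
      (measurable_one.indicator hAm).comp measurable_prodMk_right
    rw [← setLIntegral_noiseLaw hτ hr (β t q) hH]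
    have hset : MeasurableSet {e : ∀ l, K l → ℝ | (fun l => topCode r (β t q l + e l), t) ∈ A} :=
      (hm.prodMk measurable_const) hAm
    have hind : (fun e : ∀ l, K l → ℝ =>
        A.indicator (1 : (∀ l, K l → Prop × ℝ) × ℝ → ENNReal)
          (fun l => topCode r (β t q l + e l), t)) =
        {e : ∀ l, K l → ℝ | (fun l => topCode r (β t q l + e l), t) ∈ A}.indicator 1 := rfl
    rw [hind, lintegral_indicator_one hset, Measure.restrict_apply hset, Set.inter_comm]
    rfl
  have hgauss : ∀ {g : ℝ → ENNReal}, Measurable g →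
      ∫⁻ t, g t ∂gaussianReal θ v = ∫⁻ t, gaussianPDF θ v t * g t := fun hg => by
    rw [gaussianReal_of_var_ne_zero θ hv,
      lintegral_withDensity_eq_lintegral_mul _ (measurable_gaussianPDF θ v) hg]
    rfl
  have hcorr : Measurable fun x : (∀ l, K l → Prop × ℝ) × ℝ =>
      A.indicator (1 : (∀ l, K l → Prop × ℝ) × ℝ → ENNReal) x *
        ENNReal.ofReal (corrCode τ (β x.2 q) x.1) := by
    refine (measurable_one.indicator hAm).mul ?_
    have hm : Measurable fun x : (∀ l, K l → Prop × ℝ) × ℝ => (β x.2 q, x.1) :=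
      (hβ.comp (measurable_snd.prodMk measurable_const)).prodMk measurable_fst
    have hc := ((measurable_corrCode τ).comp hm).ennreal_ofReal
    exact hc
  simp_rw [hnoise]
  rw [hgauss hcorr.lintegral_prod_left']
  calc ∫⁻ t, gaussianPDF θ v t *
        ∫⁻ a, A.indicator 1 (a, t) * ENNReal.ofReal (corrCode τ (β t q) a) ∂Λ
      = ∫⁻ t, ∫⁻ a, A.indicator (fun x => ENNReal.ofReal
          (gaussianPDFReal θ v x.2 * corrCode τ (β x.2 q) x.1)) (a, t) ∂Λ := by
        refine lintegral_congr fun t => ?_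
        have hct := hcorr.comp (measurable_prodMk_right (y := t))
        simp only [Function.comp_def] at hct
        rw [← lintegral_const_mul _ hct]
        refine lintegral_congr fun a => ?_
        by_cases hx : (a, t) ∈ A
        · simp only [Set.indicator_of_mem hx, Pi.one_apply, one_mul]
          rw [ENNReal.ofReal_mul (gaussianPDFReal_nonneg _ _ _), gaussianPDF]
        · simp only [Set.indicator_of_notMem hx, zero_mul, mul_zero]
    _ = ∫⁻ a, ∫⁻ t, A.indicator (fun x => ENNReal.ofReal
          (gaussianPDFReal θ v x.2 * corrCode τ (β x.2 q) x.1)) (a, t) ∂volume ∂Λ :=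
        lintegral_lintegral_swap
          ((hfm.indicator hAm).comp measurable_swap).aemeasurable
    _ = ∫⁻ a, C.indicator (fun a => volume (S ∩ Set.Ioo 0 1) * ∫⁻ t, ENNReal.ofReal
          (gaussianPDFReal θ v t * corrCode τ (β t q) a)) a ∂Λ := by
        refine lintegral_congr fun a => ?_
        by_cases ha : a ∈ C
        · rw [Set.indicator_of_mem ha, ← setLIntegral_probabilityIntegralTransform
            (fun t => mul_nonneg (gaussianPDFReal_nonneg _ _ _) (corrCode_nonneg hτ _ _))
            (integrable_pivotIntegrand hτ hβ θ v a q) hS]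
          have hset : MeasurableSet {t | pivotCode τ β θ v a t q ∈ S} :=
            (hpiv.comp (measurable_prodMk_left (x := a))) hS
          change _ = ∫⁻ t in {t | pivotCode τ β θ v a t q ∈ S}, _
          rw [← lintegral_indicator hset]
          refine lintegral_congr fun t => ?_
          by_cases ht : pivotCode τ β θ v a t q ∈ S
          · rw [Set.indicator_of_mem (show (a, t) ∈ A from ⟨ht, ha⟩),
              Set.indicator_of_mem (show t ∈ {t | pivotCode τ β θ v a t q ∈ S} from ht)]
          · rw [Set.indicator_of_notMem (fun h : (a, t) ∈ A => ht h.1),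
              Set.indicator_of_notMem (show t ∉ {t | pivotCode τ β θ v a t q ∈ S} from ht)]
        · rw [Set.indicator_of_notMem ha]
          simp [Set.indicator_of_notMem fun h : (a, _) ∈ A => ha h.2]
    _ = _ := by
        rw [lintegral_indicator hC, lintegral_const_mul]
        exact hfm.lintegral_prod_right'

/-- On the selection event, the pivot is uniform and independent of the nuisance statistic and the
conditioned data. -/
theorem measure_posEvent_inter_pivot {τ : ι → ℝ≥0} (hτ : ∀ l, 0 < τ l) {r : ℕ}
    (hr : ∀ l, r ≤ Fintype.card (K l)) (hβ : Measurable fun x : ℝ × 𝒬 => β x.1 x.2) (θ : ℝ)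
    {v : ℝ≥0} (hv : v ≠ 0) (law : Measure 𝒬) [SFinite law] {S : Set ℝ} (hS : MeasurableSet S)
    {C : Set (𝒬 × ∀ l, K l → Prop × ℝ)} (hC : MeasurableSet C) :
    (law.prod ((gaussianReal θ v).prod (noiseLaw K τ))) (posEvent β ∩
        ({x | pivotCode τ β θ v (dataCode β r x) x.2.1 x.1 ∈ S} ∩
          {x | (x.1, dataCode β r x) ∈ C})) =
      volume (S ∩ Set.Ioo 0 1) * (law.prod ((gaussianReal θ v).prod (noiseLaw K τ)))
        (posEvent β ∩ {x | (x.1, dataCode β r x) ∈ C}) := by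
  have hprob : IsProbabilityMeasure (noiseLaw K τ) := isProbabilityMeasure_noiseLaw hτ
  have hfinite : IsFiniteMeasure (noiseLaw K τ) :=
    ⟨by rw [hprob.measure_univ]; exact ENNReal.one_lt_top⟩
  have hsigma : SFinite (noiseLaw K τ) :=
    @instSFiniteOfSigmaFinite _ _ _ (@IsFiniteMeasure.toSigmaFinite _ _ _ hfinite)
  have hCm : MeasurableSet {x : 𝒬 × ℝ × ∀ l, K l → ℝ | (x.1, dataCode β r x) ∈ C} :=
    (measurable_fst.prodMk (measurable_dataCode hβ r)) hC
  have key : ∀ S : Set ℝ, MeasurableSet S →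
      (law.prod ((gaussianReal θ v).prod (noiseLaw K τ))) (posEvent β ∩
        ({x | pivotCode τ β θ v (dataCode β r x) x.2.1 x.1 ∈ S} ∩
          {x | (x.1, dataCode β r x) ∈ C})) = ∫⁻ q, volume (S ∩ Set.Ioo 0 1) *
        (∫⁻ a in {a | (q, a) ∈ C}, (∫⁻ t, ENNReal.ofReal
          (gaussianPDFReal θ v t * corrCode τ (β t q) a))
            ∂Measure.pi fun l => codeMeasure (K l) r) ∂law := by
    intro S hS
    have hpS : MeasurableSet {x : 𝒬 × ℝ × ∀ l, K l → ℝ |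
        pivotCode τ β θ v (dataCode β r x) x.2.1 x.1 ∈ S} :=
      (measurable_pivotCode_dataCode τ hβ θ v r) hS
    have hE := (measurableSet_posEvent hβ).inter (hpS.inter hCm)
    rw [Measure.prod_apply hE]
    refine lintegral_congr fun q => ?_
    have hCq : MeasurableSet {a | (q, a) ∈ C} := measurable_prodMk_left hC
    rw [← lintegral_noiseLaw_pivot hτ hr hβ θ hv q hS hCq,
      Measure.prod_apply (measurable_prodMk_left hE)]
    rfl
  have hfin : volume (S ∩ Set.Ioo (0 : ℝ) 1) ≠ ⊤ :=
    ((measure_mono Set.inter_subset_right).trans_lt (by simp)).ne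
  have huniv := key Set.univ MeasurableSet.univ
  simp only [Set.mem_univ, Set.ofPred_true, Set.univ_inter, Real.volume_Ioo, sub_zero,
    ENNReal.ofReal_one, one_mul] at huniv
  rw [key S hS, huniv, lintegral_const_mul' _ _ hfin]

end Selection

/-! ### Decomposition of the responses -/

section Response

variable {p n : ℕ} {Ω : Type*} [MeasurableSpace Ω] {Pr : Measure Ω}

/-- The direction `ν_R` has unit length as soon as `R` contains an observation. -/
theorem nu_dotProduct_self (X : Fin n → Fin p → ℝ) {R : Set (Fin p → ℝ)}
    (hR : 0 < (obs X R).card) : nu X R ⬝ᵥ nu X R = 1 := by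
  classical
  have hR' : (0 : ℝ) < (obs X R).card := by exact_mod_cast hR
  have h1 : ∀ i, nu X R i * nu X R i = if X i ∈ R then 1 / ((obs X R).card : ℝ) else 0 := by
    intro i
    unfold nu
    split_ifs
    · rw [← mul_div_mul_comm, one_mul, Real.mul_self_sqrt hR'.le]
    · simp
  have hobs : obs X R = Finset.univ.filter fun i => X i ∈ R := by
    unfold obs; congr
  simp only [dotProduct, h1]
  rw [← Finset.sum_filter, ← hobs, Finset.sum_const, nsmul_eq_mul, mul_one_div_cancel hR'.ne']

theorem yAt_projPerp (ν y : Fin n → ℝ) : yAt ν (projPerp ν y) (ν ⬝ᵥ y) = y := by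
  simp [yAt, projPerp]

/-- The responses outside the terminal region are not affected by the projection. -/
theorem projPerp_apply_of_notMem (X : Fin n → Fin p → ℝ) {R : Set (Fin p → ℝ)} (y : Fin n → ℝ)
    {i : Fin n} (hi : X i ∉ R) : projPerp (nu X R) y i = y i := by
  simp [projPerp, nu, hi]

theorem measurable_dotProduct_left (ν : Fin n → ℝ) : Measurable fun y : Fin n → ℝ => ν ⬝ᵥ y := by
  unfold dotProduct; fun_prop

theorem measurable_projPerp (ν : Fin n → ℝ) : Measurable (projPerp ν) := by
  unfold projPerp dotProduct; fun_prop

variable {Y : Ω → Fin n → ℝ} {μ : Fin n → ℝ} {s : ℝ≥0}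

theorem hasLaw_eval (hY : HasLaw Y (Measure.pi fun i => gaussianReal (μ i) s) Pr) (i : Fin n) :
    HasLaw (fun ω => Y ω i) (gaussianReal (μ i) s) Pr :=
  (measurePreserving_eval (fun i => gaussianReal (μ i) s) i).comp_hasLaw hY

theorem memLp_dotProduct (hY : HasLaw Y (Measure.pi fun i => gaussianReal (μ i) s) Pr)
    (ν : Fin n → ℝ) : MemLp (fun ω => ν ⬝ᵥ Y ω) 2 Pr :=
  memLp_finsetSum _ fun i _ => ((hasLaw_eval hY i).hasGaussianLaw.memLp_two).const_mul _

variable [IsProbabilityMeasure Pr]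

theorem iIndepFun_eval (hY : HasLaw Y (Measure.pi fun i => gaussianReal (μ i) s) Pr) :
    iIndepFun (fun i ω => Y ω i) Pr :=
  (iIndepFun_iff_hasLaw_pi_pi fun i => hasLaw_eval hY i).2 hY

theorem covariance_eval (hY : HasLaw Y (Measure.pi fun i => gaussianReal (μ i) s) Pr)
    (i j : Fin n) : cov[fun ω => Y ω i, fun ω => Y ω j; Pr] = if i = j then (s : ℝ) else 0 := by
  have hL2 : ∀ i, MemLp (fun ω => Y ω i) 2 Pr := fun i =>
    (hasLaw_eval hY i).hasGaussianLaw.memLp_two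
  split_ifs with hij
  · subst hij
    rw [covariance_self (hL2 i).aemeasurable, (hasLaw_eval hY i).variance_eq,
      variance_id_gaussianReal]
  · exact ((iIndepFun_eval hY).indepFun hij).covariance_eq_zero (hL2 i) (hL2 j)

theorem covariance_dotProduct_eval
    (hY : HasLaw Y (Measure.pi fun i => gaussianReal (μ i) s) Pr) (ν : Fin n → ℝ) (j : Fin n) :
    cov[fun ω => ν ⬝ᵥ Y ω, fun ω => Y ω j; Pr] = s * ν j := by
  have hL2 : ∀ i, MemLp (fun ω => Y ω i) 2 Pr := fun i =>
    (hasLaw_eval hY i).hasGaussianLaw.memLp_two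
  simp only [dotProduct]
  rw [covariance_fun_sum_left (fun i => (hL2 i).const_mul _) (hL2 j)]
  simp_rw [covariance_const_mul_left, covariance_eval hY]
  simp [mul_comm]

theorem covariance_dotProduct_self
    (hY : HasLaw Y (Measure.pi fun i => gaussianReal (μ i) s) Pr) (ν : Fin n → ℝ) :
    cov[fun ω => ν ⬝ᵥ Y ω, fun ω => ν ⬝ᵥ Y ω; Pr] = s * (ν ⬝ᵥ ν) := by
  have hL2 : ∀ i, MemLp (fun ω => Y ω i) 2 Pr := fun i =>
    (hasLaw_eval hY i).hasGaussianLaw.memLp_two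
  have h1 : (fun ω => ν ⬝ᵥ Y ω) = fun ω => ∑ i, ν i * Y ω i := rfl
  nth_rewrite 2 [h1]
  rw [covariance_fun_sum_right (fun i => (hL2 i).const_mul _) (memLp_dotProduct hY ν)]
  simp_rw [covariance_const_mul_right, covariance_dotProduct_eval hY, dotProduct, Finset.mul_sum]
  exact Finset.sum_congr rfl fun i _ => by ring

theorem hasGaussianLaw_pi (hY : HasLaw Y (Measure.pi fun i => gaussianReal (μ i) s) Pr) :
    HasGaussianLaw Y Pr :=
  (iIndepFun_eval hY).hasGaussianLaw fun i => (hasLaw_eval hY i).hasGaussianLaw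

/-- The linear functional `y ↦ νᵀ y`. -/
def dotProductCLM (ν : Fin n → ℝ) : (Fin n → ℝ) →L[ℝ] ℝ :=
  LinearMap.toContinuousLinearMap (dotProductBilin ℝ ℝ ν)

theorem hasLaw_dotProduct (hY : HasLaw Y (Measure.pi fun i => gaussianReal (μ i) s) Pr)
    (ν : Fin n → ℝ) :
    HasLaw (fun ω => ν ⬝ᵥ Y ω) (gaussianReal (ν ⬝ᵥ μ) (s * (ν ⬝ᵥ ν).toNNReal)) Pr := by
  have hG : HasGaussianLaw (fun ω => ν ⬝ᵥ Y ω) Pr :=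
    (hasGaussianLaw_pi hY).map_fun (dotProductCLM ν)
  refine ⟨hG.aemeasurable, ?_⟩
  rw [hG.map_eq_gaussianReal, ← covariance_self hG.aemeasurable, covariance_dotProduct_self hY]
  congr 1
  · simp only [dotProduct]
    rw [integral_finsetSum _ fun i _ => ((hasLaw_eval hY i).hasGaussianLaw.integrable).const_mul _]
    refine Finset.sum_congr rfl fun i _ => ?_
    rw [integral_const_mul, (hasLaw_eval hY i).integral_eq, integral_id_gaussianReal]
  · rw [Real.toNNReal_mul s.coe_nonneg, Real.toNNReal_coe]

/-- The linear statistic and the projection are jointly Gaussian and uncorrelated. -/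
theorem indepFun_dotProduct_projPerp
    (hY : HasLaw Y (Measure.pi fun i => gaussianReal (μ i) s) Pr) {ν : Fin n → ℝ}
    (hν : ν ⬝ᵥ ν = 1) : IndepFun (fun ω => projPerp ν (Y ω)) (fun ω => ν ⬝ᵥ Y ω) Pr := by
  have hL2 : ∀ i, MemLp (fun ω => Y ω i) 2 Pr := fun i =>
    (hasLaw_eval hY i).hasGaussianLaw.memLp_two
  let L : (Fin n → ℝ) →L[ℝ] ((Fin n → ℝ) × (Unit → ℝ)) :=
    (ContinuousLinearMap.id ℝ (Fin n → ℝ) -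
      (dotProductCLM ν).smulRight ν).prod (ContinuousLinearMap.pi fun _ => dotProductCLM ν)
  have hL : ∀ ω, L (Y ω) = (fun i => projPerp ν (Y ω) i, fun _ => ν ⬝ᵥ Y ω) := fun ω => by
    ext i
    · simp [L, projPerp, hν, dotProductCLM]
    · simp [L, dotProductCLM]
  have hG : HasGaussianLaw
      (fun ω => (fun i => projPerp ν (Y ω) i, fun _ : Unit => ν ⬝ᵥ Y ω)) Pr := by
    simp_rw [← hL]
    exact (hasGaussianLaw_pi hY).map_fun L
  have hind := hG.indepFun_of_covariance_eval fun i _ => by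
    have hfun : (fun ω => projPerp ν (Y ω) i) = fun ω => Y ω i - ν i * (ν ⬝ᵥ Y ω) := by
      ext ω
      simp [projPerp, hν, mul_comm]
    rw [hfun, covariance_fun_sub_left (hL2 i) ((memLp_dotProduct hY ν).const_mul _)
      (memLp_dotProduct hY ν), covariance_const_mul_left, covariance_comm,
      covariance_dotProduct_eval hY, covariance_dotProduct_self hY, hν]
    ring
  exact hind.comp (φ := id) (ψ := fun f : Unit → ℝ => f ()) measurable_id (measurable_pi_apply ())

end Response

/-! ### The randomizations on and off a path of the tree -/

section Noise

variable {p n : ℕ} {Ω : Type*} [MeasurableSpace Ω] {Pr : Measure Ω}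

/-- The differences of randomizations at the ancestors of `h`. -/
def noiseDiff (X : Fin n → Fin p → ℝ) (χ : Set (Fin p → ℝ) → Finset (Split p n)) (h : Node p n)
    (w : Node p n → Split p n → ℝ) (l : Fin h.length) : Losers X χ h l → ℝ :=
  fun k => w (h.take l) (ancSplit h l) - w (h.take l) k

open Classical in
/-- The randomizations off the path to `h`: those on the path are replaced by `0`. -/
def offNoise (h : Node p n) (w : Node p n → Split p n → ℝ) : Node p n → Split p n → ℝ :=
  fun g => if g <+: h then 0 else w g

theorem measurable_noiseDiff (X : Fin n → Fin p → ℝ) (χ : Set (Fin p → ℝ) → Finset (Split p n))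
    (h : Node p n) : Measurable (noiseDiff X χ h) := by
  unfold noiseDiff; fun_prop

theorem measurable_offNoise (h : Node p n) : Measurable (offNoise (p := p) (n := n) h) := by
  refine measurable_pi_lambda _ fun g => ?_
  unfold offNoise
  split_ifs <;> fun_prop

/-- The randomizations on and off the path are functions of disjoint sets of independent
variables. -/
theorem indepFun_noiseDiff_offNoise (X : Fin n → Fin p → ℝ)
    (χ : Set (Fin p → ℝ) → Finset (Split p n)) (h : Node p n)
    {W : Ω → Node p n → Split p n → ℝ} (hWm : ∀ h s, Measurable fun ω => W ω h s)
    (hWind : iIndepFun (fun (q : Node p n × Split p n) ω => W ω q.1 q.2) Pr) :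
    IndepFun (fun ω => offNoise h (W ω)) (fun ω => noiseDiff X χ h (W ω)) Pr := by
  set m : Node p n × Split p n → MeasurableSpace Ω := fun q =>
    MeasurableSpace.comap (fun ω => W ω q.1 q.2) inferInstance with hm
  have hind := indep_iSup_of_disjoint (m := m) (fun q => (hWm q.1 q.2).comap_le)
    ((iIndepFun_iff_iIndep _ _ _).1 hWind)
    (disjoint_compl_left (a := {q : Node p n × Split p n | q.1 <+: h}))
  have hmeas : ∀ {A : Set (Node p n × Split p n)} {q : Node p n × Split p n}, q ∈ A →
      Measurable[⨆ q ∈ A, m q] fun ω => W ω q.1 q.2 := fun {A q} hq =>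
    (comap_measurable (fun ω => W ω q.1 q.2)).mono (le_iSup₂_of_le q hq le_rfl) le_rfl
  rw [IndepFun_iff_Indep]
  refine indep_of_indep_of_le_left (indep_of_indep_of_le_right hind ?_) ?_
  · rw [← measurable_iff_comap_le]
    refine @measurable_pi_lambda _ _ _ (_) _ _ fun l =>
      @measurable_pi_lambda _ _ _ (_) _ _ fun k => ?_
    exact (hmeas (q := (h.take l, ancSplit h l)) (List.take_prefix _ _)).sub
      (hmeas (q := (h.take l, (k : Split p n))) (List.take_prefix _ _))
  · rw [← measurable_iff_comap_le]
    refine @measurable_pi_lambda _ _ _ (_) _ _ fun g =>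
      @measurable_pi_lambda _ _ _ (_) _ _ fun k => ?_
    by_cases hg : g <+: h
    · simp only [offNoise, hg, if_true]
      exact measurable_const
    · simp only [offNoise, hg, if_false]
      exact hmeas (q := (g, k)) hg

theorem take_injective (h : Node p n) : Function.Injective fun l : Fin h.length => h.take l := by
  intro l l' hl
  have := congrArg List.length hl
  simp only [List.length_take] at this
  ext
  omega

/-- The rows of an array of independent variables are independent. -/
theorem iIndepFun_rows {ι κ : Type*} {W : Ω → ι → κ → ℝ}
    (hWm : ∀ i j, Measurable fun ω => W ω i j)
    (hWind : iIndepFun (fun (q : ι × κ) ω => W ω q.1 q.2) Pr) :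
    iIndepFun (fun i ω => W ω i) Pr := by
  have hprob := hWind.isProbabilityMeasure
  have hW : ∀ i, Measurable fun ω => W ω i := fun i => measurable_pi_iff.2 (hWm i)
  have hp : ∀ i j, IsProbabilityMeasure (Pr.map fun ω => W ω i j) := fun i j =>
    Measure.isProbabilityMeasure_map (hWm i j).aemeasurable
  have h1 := hWind.map_fun_eq_infinitePi_map fun q : ι × κ => hWm q.1 q.2
  have hrow : ∀ i, Pr.map (fun ω => W ω i) =
      Measure.infinitePi fun j => Pr.map fun ω => W ω i j := fun i =>
    (hWind.precomp (g := fun j => (i, j)) fun j j' h => (Prod.mk.inj h).2).map_fun_eq_infinitePi_map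
      (hWm i)
  rw [iIndepFun_iff_map_fun_eq_infinitePi_map hW]
  simp_rw [hrow]
  rw [← Measure.infinitePi_map_curry fun i j => Pr.map fun ω => W ω i j, ← h1,
    Measure.map_map (by fun_prop) (by fun_prop)]
  rfl

/-- Different ancestors of `h` are different nodes, so their randomizations are independent. -/
theorem map_noiseDiff (X : Fin n → Fin p → ℝ) (χ : Set (Fin p → ℝ) → Finset (Split p n))
    {τ : Set (Fin p → ℝ) → ℝ≥0} (hτ : ∀ P, 0 < τ P) (h : Node p n)
    {W : Ω → Node p n → Split p n → ℝ} (hWm : ∀ h s, Measurable fun ω => W ω h s)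
    (hW : ∀ h s, HasLaw (fun ω => W ω h s) (gaussianReal 0 (τ (region X h) ^ 2)) Pr)
    (hWind : iIndepFun (fun (q : Node p n × Split p n) ω => W ω q.1 q.2) Pr) :
    Pr.map (fun ω => noiseDiff X χ h (W ω)) =
      noiseLaw (fun l => Losers X χ h l) fun l => τ (parent X h l) := by
  have hfun : ∀ l : Fin h.length, Measurable fun w : Split p n → ℝ =>
      fun k : Losers X χ h l => w (ancSplit h l) - w k := fun l => by fun_prop
  have hind := (((iIndepFun_rows hWm hWind).precomp (take_injective h)).comp _ hfun)
  have hpi := hind.map_fun_eq_pi_map fun l =>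
    ((hfun l).comp (measurable_pi_iff.2 (hWm (h.take l)))).aemeasurable
  refine hpi.trans ?_
  unfold noiseLaw
  congr 1
  funext l
  refine map_sub_eq_withDensity (hτ (parent X h l)) (ξ := fun (o : Option (Losers X χ h l)) ω =>
      W ω (h.take l) (o.elim (ancSplit h l) fun k => k)) (fun o => hWm _ _)
    (fun o => hW _ _) (hWind.precomp
      (g := fun o : Option (Losers X χ h l) => (h.take l, o.elim (ancSplit h l) fun k => k)) ?_)
  intro o o' ho
  have ho2 := (Prod.mk.inj ho).2
  rcases o with _ | k <;> rcases o' with _ | k'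
  · rfl
  · exact absurd ho2.symm (Finset.ne_of_mem_erase k'.2)
  · exact absurd ho2 (Finset.ne_of_mem_erase k.2)
  · exact congrArg some (Subtype.ext ho2)

end Noise

/-! ### Joint law -/

section Joint

variable {α β γ δ : Type*} [MeasurableSpace α] [MeasurableSpace β] [MeasurableSpace γ]
  [MeasurableSpace δ]

theorem measurePreserving_prodProdProdComm (a : Measure α) (b : Measure β) (c : Measure γ)
    (d : Measure δ) [SFinite a] [SFinite b] [SFinite c] [SFinite d] :
    MeasurePreserving (fun x : (α × β) × (γ × δ) => ((x.1.1, x.2.1), (x.1.2, x.2.2)))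
      ((a.prod b).prod (c.prod d)) ((a.prod c).prod (b.prod d)) := by
  have h1 := measurePreserving_prodAssoc a b (c.prod d)
  have h2 := (MeasurePreserving.id a).prod ((measurePreserving_prodAssoc b c d).symm)
  have h3 := (MeasurePreserving.id a).prod
    ((Measure.measurePreserving_swap (μ := b) (ν := c)).prod (MeasurePreserving.id d))
  have h4 := (MeasurePreserving.id a).prod (measurePreserving_prodAssoc c b d)
  have h5 := (measurePreserving_prodAssoc a c (b.prod d)).symm
  exact h5.comp (h4.comp (h3.comp (h2.comp h1)))

theorem map_prodMk_prodMk {Ω : Type*} [MeasurableSpace Ω] {P : Measure Ω} [IsProbabilityMeasure P]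
    {A : Ω → α} {B : Ω → β} {C : Ω → γ} {D : Ω → δ} (hA : Measurable A) (hB : Measurable B)
    (hC : Measurable C) (hD : Measurable D) (hAB : IndepFun A B P) (hCD : IndepFun C D P)
    (h : IndepFun (fun ω => (A ω, B ω)) (fun ω => (C ω, D ω)) P) :
    P.map (fun ω => ((A ω, C ω), (B ω, D ω))) =
      (P.map fun ω => (A ω, C ω)).prod ((P.map B).prod (P.map D)) := by
  have hAC : IndepFun A C P := h.comp measurable_fst measurable_fst
  have h1 := (indepFun_iff_map_prod_eq_prod_map_map (hA.prodMk hB).aemeasurable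
    (hC.prodMk hD).aemeasurable).1 h
  rw [(indepFun_iff_map_prod_eq_prod_map_map hA.aemeasurable hB.aemeasurable).1 hAB,
    (indepFun_iff_map_prod_eq_prod_map_map hC.aemeasurable hD.aemeasurable).1 hCD] at h1
  rw [(indepFun_iff_map_prod_eq_prod_map_map hA.aemeasurable hC.aemeasurable).1 hAC]
  have h2 := (measurePreserving_prodProdProdComm (P.map A) (P.map B) (P.map C) (P.map D)).map_eq
  rw [← h1, Measure.map_map (by fun_prop) (by fun_prop)] at h2
  exact h2

end Joint

/-! ### The pivot of a randomized tree -/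

section TreePivot

variable {p n : ℕ} {X : Fin n → Fin p → ℝ} {χ : Set (Fin p → ℝ) → Finset (Split p n)}
  {G : (Fin n → ℝ) → Set (Fin p → ℝ) → Split p n → ℝ}

theorem randGainDiff_eq (h : Node p n) (y : Fin n → ℝ) (w : Node p n → Split p n → ℝ)
    (l : Fin h.length) :
    randGainDiff X χ G h y w l = gainDiff X χ G h y l + noiseDiff X χ h w l := by
  ext k
  simp only [randGainDiff, gainDiff, noiseDiff, Pi.add_apply]
  ring

theorem measurable_gainDiff (hG : IsGain X G) (h : Node p n) :
    Measurable fun y => gainDiff X χ G h y :=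
  measurable_pi_lambda _ fun l => measurable_pi_lambda _ fun k =>
    (hG (parent X h l) (ancSplit h l)).1.sub (hG (parent X h l) k).1

variable (X χ G) in
/-- The differences of gains on the line of responses through `q.1` in the direction `ν_R`, as a
function of the linear statistic `t`; the nuisance statistic `q` consists of the projection of the
responses and of the randomizations off the path. -/
def lineGainDiff (h : Node p n) (t : ℝ) (q : (Fin n → ℝ) × (Node p n → Split p n → ℝ))
    (l : Fin h.length) : Losers X χ h l → ℝ :=
  gainDiff X χ G h (yAt (nu X (region X h)) q.1 t) l

theorem measurable_lineGainDiff (hG : IsGain X G) (h : Node p n) :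
    Measurable fun x : ℝ × (Fin n → ℝ) × (Node p n → Split p n → ℝ) =>
      lineGainDiff X χ G h x.1 x.2 := by
  have hy : Measurable fun x : ℝ × (Fin n → ℝ) × (Node p n → Split p n → ℝ) =>
      yAt (nu X (region X h)) x.2.1 x.1 := by
    unfold yAt; fun_prop
  have hc := (measurable_gainDiff (χ := χ) hG h).comp hy
  exact hc

variable (X χ) in
/-- The data in the coordinates of the argument: the nuisance statistic, the linear statistic and
the differences of randomizations on the path. -/
def coords (h : Node p n) (y : Fin n → ℝ) (w : Node p n → Split p n → ℝ) :
    ((Fin n → ℝ) × (Node p n → Split p n → ℝ)) × ℝ × ∀ l, Losers X χ h l → ℝ :=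
  ((projPerp (nu X (region X h)) y, offNoise h w), (nu X (region X h) ⬝ᵥ y, noiseDiff X χ h w))

theorem lineGainDiff_coords (h : Node p n) (y : Fin n → ℝ) (w : Node p n → Split p n → ℝ)
    (l : Fin h.length) :
    lineGainDiff X χ G h (coords X χ h y w).2.1 (coords X χ h y w).1 l +
      (coords X χ h y w).2.2 l = randGainDiff X χ G h y w l := by
  rw [randGainDiff_eq]
  simp only [lineGainDiff, coords, yAt_projPerp]

theorem condInfo_eq (h : Node p n) (r : ℕ) (y : Fin n → ℝ) (w : Node p n → Split p n → ℝ) :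
    condInfo X χ G h r y w = dataCode (lineGainDiff X χ G h) r (coords X χ h y w) := by
  funext l
  simp only [dataCode, lineGainDiff_coords]
  rfl

theorem dataPivot_eq (τ : Set (Fin p → ℝ) → ℝ≥0) (σ : ℝ≥0) (μ : Fin n → ℝ) (h : Node p n) (r : ℕ)
    (y : Fin n → ℝ) (w : Node p n → Split p n → ℝ) :
    dataPivot X χ G τ σ μ h r y w =
      pivotCode (fun l => τ (parent X h l)) (lineGainDiff X χ G h) (nu X (region X h) ⬝ᵥ μ)
        (σ ^ 2 * (nu X (region X h) ⬝ᵥ nu X (region X h)).toNNReal)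
        (dataCode (lineGainDiff X χ G h) r (coords X χ h y w)) (coords X χ h y w).2.1
        (coords X χ h y w).1 := by
  have hγ : ∀ t, gammaProd X χ G τ h (topSets X χ G h r y w) (topVals X χ G h r y w) t
        (projPerp (nu X (region X h)) y) =
      corrCode (fun l => τ (parent X h l)) (lineGainDiff X χ G h t (coords X χ h y w).1)
        (dataCode (lineGainDiff X χ G h) r (coords X χ h y w)) := by
    intro t
    unfold gammaProd corrCode
    refine Finset.prod_congr rfl fun l _ => ?_
    simp only [dataCode, lineGainDiff_coords, gammaCode_topCode]
    rfl
  unfold dataPivot pivot pivotCode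
  simp only [hγ]
  rfl

theorem mem_posEvent_iff (h : Node p n) (y : Fin n → ℝ) (w : Node p n → Split p n → ℝ) :
    coords X χ h y w ∈ posEvent (lineGainDiff X χ G h) ↔
      ∀ l k, 0 < randGainDiff X χ G h y w l k := by
  simp only [← lineGainDiff_coords, Pi.add_apply]
  rfl

/-- In the absence of ties, the tree `T` is grown iff the nuisance statistic is compatible with `T`
off the path to `h` and the splits on this path win. -/
theorem grow_eq_iff_coords (hG : IsGain X G) {h : Node p n} {k : ℕ} {T : SplitTree p n}
    (hh : h ∈ T.leaves) (hmem : ∀ l : Fin h.length, ancSplit h l ∈ χ (parent X h l))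
    {y : Fin n → ℝ} {w : Node p n → Split p n → ℝ}
    (hne : ∀ l k, randGainDiff X χ G h y w l k ≠ 0) :
    grow X χ G y w k [] = T ↔
      OffPath X χ G (coords X χ h y w).1.1 (coords X χ h y w).1.2 k [] T h ∧
        coords X χ h y w ∈ posEvent (lineGainDiff X χ G h) := by
  rw [grow_eq_iff k [] T h hh, mem_posEvent_iff, ← forall_isChosen_iff hmem hne]
  refine and_congr (offPath_congr hG k [] T h (fun i hi => ?_) fun g hg => ?_) Iff.rfl
  · exact (projPerp_apply_of_notMem X y hi).symm
  · exact (if_neg hg).symm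

theorem measurable_coords (h : Node p n) :
    Measurable fun x : (Fin n → ℝ) × (Node p n → Split p n → ℝ) => coords X χ h x.1 x.2 :=
  (((measurable_projPerp _).comp measurable_fst).prodMk
    ((measurable_offNoise h).comp measurable_snd)).prodMk
    (((measurable_dotProduct_left _).comp measurable_fst).prodMk
      ((measurable_noiseDiff X χ h).comp measurable_snd))

theorem ae_noiseLaw_add_ne_zero {ι : Type*} [Fintype ι] {K : ι → Type*} [∀ l, Fintype (K l)]
    [∀ l, DecidableEq (K l)] {τ : ι → ℝ≥0} (hτ : ∀ l, 0 < τ l) (b : ∀ l, K l → ℝ) :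
    ∀ᵐ e ∂noiseLaw K τ, ∀ l k, b l k + e l k ≠ 0 := by
  have hprob := fun l => isProbabilityMeasure_withDensity_diffCov (κ := K l) (hτ l) 0
  rw [ae_all_iff]
  intro l
  rw [ae_all_iff]
  intro k
  have h1 : ∀ᵐ e : K l → ℝ, e k ≠ -b l k :=
    Measure.ae_eval_ne (μ := fun _ : K l => (volume : Measure ℝ)) k _
  have h2 := (Measure.quasiMeasurePreserving_eval (fun l => volume.withDensity fun e =>
    ENNReal.ofReal (gaussDensity 0 (diffCov (K l) (τ l)) e)) l).ae
      ((withDensity_absolutelyContinuous _ _).ae_le h1)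
  filter_upwards [h2] with e he h0
  exact he (by linarith)

section Probability

variable {τ : Set (Fin p → ℝ) → ℝ≥0} {μ : Fin n → ℝ} {σ : ℝ≥0}
  {Ω : Type*} [MeasurableSpace Ω] {Pr : Measure Ω} [IsProbabilityMeasure Pr]
  {Y : Ω → Fin n → ℝ} {W : Ω → Node p n → Split p n → ℝ}

/-- The nuisance statistic, the linear statistic and the differences of randomizations on the path
are independent. -/
theorem map_coords (hτ : ∀ P, 0 < τ P) (hYm : Measurable Y)
    (hY : HasLaw Y (Measure.pi fun i => gaussianReal (μ i) (σ ^ 2)) Pr)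
    (hWm : ∀ h s, Measurable fun ω => W ω h s)
    (hW : ∀ h s, HasLaw (fun ω => W ω h s) (gaussianReal 0 (τ (region X h) ^ 2)) Pr)
    (hWind : iIndepFun (fun (q : Node p n × Split p n) ω => W ω q.1 q.2) Pr)
    (hYW : IndepFun Y W Pr) {h : Node p n} (hR : 0 < (obs X (region X h)).card) :
    Pr.map (fun ω => coords X χ h (Y ω) (W ω)) =
      (Pr.map fun ω => (projPerp (nu X (region X h)) (Y ω), offNoise h (W ω))).prod
        ((gaussianReal (nu X (region X h) ⬝ᵥ μ)
          (σ ^ 2 * (nu X (region X h) ⬝ᵥ nu X (region X h)).toNNReal)).prod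
          (noiseLaw (fun l => Losers X χ h l) fun l => τ (parent X h l))) := by
  have hWm' : Measurable W := measurable_pi_iff.2 fun g => measurable_pi_iff.2 (hWm g)
  rw [← map_noiseDiff X χ hτ h hWm hW hWind, ← (hasLaw_dotProduct hY _).map_eq]
  refine map_prodMk_prodMk ((measurable_projPerp _).comp hYm)
    ((measurable_dotProduct_left _).comp hYm) ((measurable_offNoise h).comp hWm')
    ((measurable_noiseDiff X χ h).comp hWm')
    (indepFun_dotProduct_projPerp hY (nu_dotProduct_self X hR))
    (indepFun_noiseDiff_offNoise X χ h hWm hWind) ?_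
  exact hYW.comp ((measurable_projPerp _).prodMk (measurable_dotProduct_left _))
    ((measurable_offNoise h).prodMk (measurable_noiseDiff X χ h))

/-- Ties between the randomized gains of a chosen and a losing split have probability zero. -/
theorem ae_randGainDiff_ne_zero (hG : IsGain X G) (hτ : ∀ P, 0 < τ P) (hYm : Measurable Y)
    (hWm : ∀ h s, Measurable fun ω => W ω h s)
    (hW : ∀ h s, HasLaw (fun ω => W ω h s) (gaussianReal 0 (τ (region X h) ^ 2)) Pr)
    (hWind : iIndepFun (fun (q : Node p n × Split p n) ω => W ω q.1 q.2) Pr)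
    (hYW : IndepFun Y W Pr) (h : Node p n) :
    ∀ᵐ ω ∂Pr, ∀ l k, randGainDiff X χ G h (Y ω) (W ω) l k ≠ 0 := by
  have hWm' : Measurable W := measurable_pi_iff.2 fun g => measurable_pi_iff.2 (hWm g)
  have hε : Measurable fun ω => noiseDiff X χ h (W ω) := (measurable_noiseDiff X χ h).comp hWm'
  have hind : IndepFun Y (fun ω => noiseDiff X χ h (W ω)) Pr :=
    hYW.comp measurable_id (measurable_noiseDiff X χ h)
  have hlaw := (indepFun_iff_map_prod_eq_prod_map_map hYm.aemeasurable hε.aemeasurable).1 hind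
  have hset : MeasurableSet {x : (Fin n → ℝ) × ∀ l, Losers X χ h l → ℝ |
      ∀ l k, gainDiff X χ G h x.1 l k + x.2 l k ≠ 0} := by
    rw [Set.ofPred_forall]
    refine MeasurableSet.iInter fun l => ?_
    rw [Set.ofPred_forall]
    refine MeasurableSet.iInter fun k => ?_
    have hgm : Measurable fun x : (Fin n → ℝ) × ∀ l, Losers X χ h l → ℝ =>
        gainDiff X χ G h x.1 l k + x.2 l k := by
      refine Measurable.add ?_ (by fun_prop)
      exact ((hG (parent X h l) (ancSplit h l)).1.sub (hG (parent X h l) k).1).comp measurable_fst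
    exact (hgm (measurableSet_singleton 0)).compl
  have hprod : ∀ᵐ x ∂(Pr.map Y).prod (Pr.map fun ω => noiseDiff X χ h (W ω)),
      ∀ l k, gainDiff X χ G h x.1 l k + x.2 l k ≠ 0 := by
    rw [ae_iff, ← Set.compl_ofPred, Measure.measure_prod_null hset.compl]
    refine Filter.Eventually.of_forall fun y => ?_
    rw [map_noiseDiff X χ hτ h hWm hW hWind]
    exact ae_noiseLaw_add_ne_zero (fun l => hτ _) (gainDiff X χ G h y)
  rw [← hlaw, ae_map_iff (hYm.prodMk hε).aemeasurable hset] at hprod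
  filter_upwards [hprod] with ω hω l k
  rw [randGainDiff_eq]
  exact hω l k

/-- On the event that `T` is grown, the pivot is uniform and independent of the projection of the
responses and of the conditioned data. -/
theorem measure_grow_inter_dataPivot (hG : IsGain X G) (hτ : ∀ P, 0 < τ P) (hσ : 0 < σ)
    (hYm : Measurable Y)
    (hY : HasLaw Y (Measure.pi fun i => gaussianReal (μ i) (σ ^ 2)) Pr)
    (hWm : ∀ h s, Measurable fun ω => W ω h s)
    (hW : ∀ h s, HasLaw (fun ω => W ω h s) (gaussianReal 0 (τ (region X h) ^ 2)) Pr)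
    (hWind : iIndepFun (fun (q : Node p n × Split p n) ω => W ω q.1 q.2) Pr)
    (hYW : IndepFun Y W Pr) {k : ℕ} {T : SplitTree p n} {h : Node p n} (hh : h ∈ T.leaves)
    (hR : 0 < (obs X (region X h)).card)
    (hmem : ∀ l : Fin h.length, ancSplit h l ∈ χ (parent X h l)) {r : ℕ}
    (hr : ∀ l : Fin h.length, r ≤ (χ (parent X h l)).card - 1)
    {S : Set ℝ} (hS : MeasurableSet S)
    {C : Set ((Fin n → ℝ) × ∀ l, Losers X χ h l → Prop × ℝ)} (hC : MeasurableSet C) :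
    Pr ({ω | grow X χ G (Y ω) (W ω) k [] = T} ∩
        ((fun ω => dataPivot X χ G τ σ μ h r (Y ω) (W ω)) ⁻¹' S ∩
          (fun ω => (projPerp (nu X (region X h)) (Y ω), condInfo X χ G h r (Y ω) (W ω))) ⁻¹' C)) =
      volume (S ∩ Set.Ioo 0 1) * Pr ({ω | grow X χ G (Y ω) (W ω) k [] = T} ∩
        (fun ω => (projPerp (nu X (region X h)) (Y ω),
          condInfo X χ G h r (Y ω) (W ω))) ⁻¹' C) := by
  have hWm' : Measurable W := measurable_pi_iff.2 fun g => measurable_pi_iff.2 (hWm g)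
  have hcm : Measurable fun ω => coords X χ h (Y ω) (W ω) :=
    (measurable_coords h).comp (hYm.prodMk hWm')
  have hβ := measurable_lineGainDiff (χ := χ) hG h
  have hcard : ∀ l, Fintype.card (Losers X χ h l) = (χ (parent X h l)).card - 1 := fun l => by
    rw [Fintype.card_coe, Finset.card_erase_of_mem (hmem l)]
  have hv : σ ^ 2 * (nu X (region X h) ⬝ᵥ nu X (region X h)).toNNReal ≠ 0 := by
    rw [nu_dotProduct_self X hR, Real.toNNReal_one, mul_one]
    exact (pow_pos hσ 2).ne'
  set C' : Set (((Fin n → ℝ) × (Node p n → Split p n → ℝ)) × ∀ l, Losers X χ h l → Prop × ℝ) :=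
    {x | OffPath X χ G x.1.1 x.1.2 k [] T h ∧ (x.1.1, x.2) ∈ C} with hC'
  have hC'm : MeasurableSet C' := by
    refine (measurable_fst (measurableSet_offPath hG k [] T h)).inter ?_
    exact ((measurable_fst.comp measurable_fst).prodMk measurable_snd) hC
  -- the condition off the path concerns the nuisance statistic, so it is absorbed into `C`
  have key := measure_posEvent_inter_pivot (τ := fun l => τ (parent X h l)) (fun l => hτ _)
    (fun l => (hr l).trans_eq (hcard l).symm) hβ (nu X (region X h) ⬝ᵥ μ) hv
    (Pr.map fun ω => (projPerp (nu X (region X h)) (Y ω), offNoise h (W ω))) hS hC'm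
  have hP1 := measurableSet_posEvent hβ
  have hP2 : MeasurableSet {x | (x.1, dataCode (lineGainDiff X χ G h) r x) ∈ C'} :=
    (measurable_fst.prodMk (measurable_dataCode hβ r)) hC'm
  have hP3 : MeasurableSet {x | pivotCode (fun l => τ (parent X h l)) (lineGainDiff X χ G h)
      (nu X (region X h) ⬝ᵥ μ) (σ ^ 2 * (nu X (region X h) ⬝ᵥ nu X (region X h)).toNNReal)
      (dataCode (lineGainDiff X χ G h) r x) x.2.1 x.1 ∈ S} :=
    (measurable_pivotCode_dataCode (fun l => τ (parent X h l)) hβ _ _ r) hS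
  rw [← map_coords hτ hYm hY hWm hW hWind hYW hR, Measure.map_apply hcm (hP1.inter hP2),
    Measure.map_apply hcm (hP1.inter (hP3.inter hP2))] at key
  have hne := ae_randGainDiff_ne_zero (χ := χ) hG hτ hYm hWm hW hWind hYW h
  refine Eq.trans (measure_congr ?_) (key.trans (congrArg _ (measure_congr ?_)))
  · filter_upwards [hne] with ω hω
    refine propext ?_
    change (_ = T ∧ dataPivot X χ G τ σ μ h r (Y ω) (W ω) ∈ S ∧ (_, _) ∈ C) ↔ _
    rw [grow_eq_iff_coords hG hh hmem hω, dataPivot_eq, condInfo_eq]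
    change _ ↔ (_ ∧ _ ∧ _ ∧ _)
    tauto
  · filter_upwards [hne] with ω hω
    refine propext ?_
    change _ ↔ (_ = T ∧ (_, condInfo X χ G h r (Y ω) (W ω)) ∈ C)
    rw [grow_eq_iff_coords hG hh hmem hω, condInfo_eq]
    change (_ ∧ _ ∧ _) ↔ _
    tauto

theorem measurable_dataPivot (hG : IsGain X G) (hYm : Measurable Y) (hWm : Measurable W)
    (h : Node p n) (r : ℕ) :
    Measurable fun ω => dataPivot X χ G τ σ μ h r (Y ω) (W ω) := by
  simp_rw [dataPivot_eq]
  have hc := (measurable_pivotCode_dataCode (fun l => τ (parent X h l))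
    (measurable_lineGainDiff (χ := χ) hG h) (nu X (region X h) ⬝ᵥ μ)
    (σ ^ 2 * (nu X (region X h) ⬝ᵥ nu X (region X h)).toNNReal) r).comp
      ((measurable_coords h).comp (hYm.prodMk hWm))
  exact hc

end Probability

end TreePivot

end RRT

end

theorem theorem2 {p n : ℕ} (X : Fin n → Fin p → ℝ)
    (χ : Set (Fin p → ℝ) → Finset (RRT.Split p n))
    (G : (Fin n → ℝ) → Set (Fin p → ℝ) → RRT.Split p n → ℝ) (hG : RRT.IsGain X G)
    (τ : Set (Fin p → ℝ) → ℝ≥0) (hτ : ∀ P, 0 < τ P)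
    (μ : Fin n → ℝ) (σ : ℝ≥0) (hσ : 0 < σ) (dmax : ℕ)
    {Ω : Type*} [MeasurableSpace Ω] (Pr : Measure Ω) [IsProbabilityMeasure Pr]
    (Y : Ω → Fin n → ℝ) (hYm : Measurable Y)
    (hY : HasLaw Y (Measure.pi fun i => gaussianReal (μ i) (σ ^ 2)) Pr)
    (W : Ω → RRT.Node p n → RRT.Split p n → ℝ) (hWm : ∀ h s, Measurable fun ω => W ω h s)
    (hW : ∀ h s, HasLaw (fun ω => W ω h s) (gaussianReal 0 (τ (RRT.region X h) ^ 2)) Pr)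
    (hWind : iIndepFun (fun (q : RRT.Node p n × RRT.Split p n) ω => W ω q.1 q.2) Pr)
    (hYW : IndepFun Y W Pr)
    -- the observed collection `T` of all splits, which occurs with positive probability
    (T : RRT.SplitTree p n)
    (hT : Pr {ω | RRT.grow X χ G (Y ω) (W ω) dmax [] = T} ≠ 0)
    -- an observed terminal region, given by its node, which contains observations
    (h : RRT.Node p n) (hh : h ∈ T.leaves) (hR : 0 < (RRT.obs X (RRT.region X h)).card)
    (r : ℕ) (hr1 : 1 ≤ r)
    (hr2 : ∀ l : Fin h.length, r ≤ (χ (RRT.parent X h l)).card - 1) :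
    -- the pivot is uniformly distributed conditionally on the splits
    HasLaw (fun ω => RRT.dataPivot X χ G τ σ μ h r (Y ω) (W ω))
      (volume.restrict (Set.Ioo (0 : ℝ) 1))
      (ProbabilityTheory.cond Pr {ω | RRT.grow X χ G (Y ω) (W ω) dmax [] = T}) ∧
    -- and it remains so under the additional conditioning
    IndepFun (fun ω => RRT.dataPivot X χ G τ σ μ h r (Y ω) (W ω))
      (fun ω => (RRT.projPerp (RRT.nu X (RRT.region X h)) (Y ω),
        RRT.condInfo X χ G h r (Y ω) (W ω)))
      (ProbabilityTheory.cond Pr {ω | RRT.grow X χ G (Y ω) (W ω) dmax [] = T}) ∧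
    -- dimension of the conditioned values and of the box integrals
    (∀ (y : Fin n → ℝ) (w : RRT.Node p n → RRT.Split p n → ℝ) (l : Fin h.length),
      (RRT.topSets X χ G h r y w l).card = (χ (RRT.parent X h l)).card - 1 - r ∧
      ((RRT.topSets X χ G h r y w l)ᶜ).card = r) ∧
    -- for `r = 1` every factor of the correction needs a single one-dimensional integral
    (r = 1 → ∀ (y : Fin n → ℝ) (w : RRT.Node p n → RRT.Split p n → ℝ) (l : Fin h.length),
      ∃ k : ↥((RRT.topSets X χ G h r y w l)ᶜ), ∀ β : RRT.Losers X χ h l → ℝ,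
        RRT.gammaFactor (RRT.Omega X χ τ h l) β (RRT.topSets X χ G h r y w l)
            (RRT.topVals X χ G h r y w l) =
          RRT.topDensity (RRT.Omega X χ τ h l) β (RRT.topSets X χ G h r y w l)
              (RRT.topVals X χ G h r y w l) *
            ∫ x in {x : ℝ | 0 < x ∧ (x : EReal) <
                RRT.minVal (RRT.topSets X χ G h r y w l) (RRT.topVals X χ G h r y w l)},
              gaussianPDFReal
                (RRT.condMean (RRT.Omega X χ τ h l) β (RRT.topSets X χ G h r y w l)
                  (RRT.topVals X χ G h r y w l) k)
                (RRT.condCov (RRT.Omega X χ τ h l)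
                  (RRT.topSets X χ G h r y w l) k k).toNNReal x) := by
  have hWm' : Measurable W := measurable_pi_iff.2 fun g => measurable_pi_iff.2 (hWm g)
  set E := {ω | RRT.grow X χ G (Y ω) (W ω) dmax [] = T} with hE
  have hEm : MeasurableSet E :=
    (hYm.prodMk hWm') (RRT.measurableSet_grow_eq hG dmax [] T)
  have hET : Pr E ≠ ⊤ := measure_ne_top _ _
  -- the tree is grown with positive probability, so its splits on the path are allowed ones
  have hmem : ∀ l : Fin h.length, RRT.ancSplit h l ∈ χ (RRT.parent X h l) := by
    obtain ⟨ω, hω⟩ := nonempty_of_measure_ne_zero hT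
    exact fun l => (((RRT.grow_eq_iff dmax [] T h hh).1 hω).2 l).1
  have hcard : ∀ l, Fintype.card (RRT.Losers X χ h l) =
      (χ (RRT.parent X h l)).card - 1 := fun l => by
    rw [Fintype.card_coe, Finset.card_erase_of_mem (hmem l)]
  have hcompl : ∀ (y : Fin n → ℝ) (w : RRT.Node p n → RRT.Split p n → ℝ) (l : Fin h.length),
      ((RRT.topSets X χ G h r y w l)ᶜ).card = r := fun y w l =>
    RRT.card_compl_topIdx _ ((hr2 l).trans_eq (hcard l).symm)
  have hpiv : Measurable fun ω => RRT.dataPivot X χ G τ σ μ h r (Y ω) (W ω) :=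
    RRT.measurable_dataPivot hG hYm hWm' h r
  have key := fun (S : Set ℝ) (hS : MeasurableSet S) (C : Set ((Fin n → ℝ) × _))
    (hC : MeasurableSet C) => RRT.measure_grow_inter_dataPivot (k := dmax) hG hτ hσ hYm hY hWm hW
      hWind hYW hh hR hmem hr2 hS hC
  have hunif : ∀ S : Set ℝ, MeasurableSet S →
      ProbabilityTheory.cond Pr E
        ((fun ω => RRT.dataPivot X χ G τ σ μ h r (Y ω) (W ω)) ⁻¹' S) =
      volume (S ∩ Set.Ioo 0 1) := by
    intro S hS
    have h1 := key S hS Set.univ MeasurableSet.univ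
    rw [Set.preimage_univ, Set.inter_univ, Set.inter_univ] at h1
    rw [cond_apply hEm, h1, mul_left_comm, ENNReal.inv_mul_cancel hT hET, mul_one]
  refine ⟨⟨hpiv.aemeasurable, ?_⟩, ?_, fun y w l => ⟨?_, hcompl y w l⟩, ?_⟩
  · ext S hS
    rw [Measure.map_apply hpiv hS, hunif S hS, Measure.restrict_apply hS]
  · rw [indepFun_iff_measure_inter_preimage_eq_mul]
    intro S C hS hC
    rw [hunif S hS, cond_apply hEm, cond_apply hEm, key S hS C hC, mul_left_comm]
  · rw [← hcard l]
    exact RRT.card_topIdx _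
  · rintro rfl y w l
    obtain ⟨k, hk⟩ := RRT.exists_setIntegral_box_eq (hcompl y w l)
    exact ⟨k, fun β => congrArg _ (hk _ _ _)⟩
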